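/- Let $m\ge 1$, $\nu,c>0$, and consider the flux-limited porous medium equation (FLPME) $$u_t=\big(\mathbf a(u,u_x)\big)_x\ \text{ on }(0,T)\times\mathbb R,\qquad \mathbf a(z,\xi)=\frac{\nu\,m z^{m}\xi}{\sqrt{1+\frac{\nu^2}{c^2}\,(m z^{m-1}\xi)^2}}\quad(z\ge 0),$$ i.e. $u_t=\nu\Big(\frac{u\,(u^m)_x}{\sqrt{1+\frac{\nu^2}{c^2}|(u^m)_x|^2}}\Big)_x$ for $u\ge 0$. Put $h(z,\xi)=\mathbf a(z,\xi)\,\xi$, $T_{a,b}(r)=\max(\min(b,r),a)$, and $J_q(r)=\int_0^r q(s)\,ds$. A measurable $u:(0,T)\times\mathbb R\to[0,\infty)$ is an *entropy super-solution* in $Q_T=(0,T)\times\mathbb R$ if $u\in C([0,T];L^1(\mathbb R))$; $T_{a,b}(u)-a\in L^1_{loc,w}(0,T;BV_{loc}(\mathbb R))$ for all $0<a<b$ (weakly$^*$ measurable with locally integrable norm); $\mathbf a(u,\nabla u)(t)\in L^\infty_{loc}(\mathbb R)$ for a.e. $t$, where $\nabla u$ is determined by $\nabla T_{a,b}(u)=\nabla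 u\,\chi_{\{a<u<b\}}$ a.e.; and $$\int_0^T\!\!\langle h_S(u,DT(u)),\phi\rangle\,dt+\int_0^T\!\!\langle h_T(u,DS(u)),\phi\rangle\,dt\le\int_0^T\!\!\int_{\mathbb R}\big\{J_{TS}(u)\,\phi_t-\mathbf a(u,\nabla u)\,\phi_x\,T(u)S(u)\big\}\,dx\,dt$$ (all time integrands being integrable) for all $0\le\phi\in C_c^\infty(Q_T)$ and all truncations $T=T_{a,b}-l\ge 0$, $S=T_{a',b'}-l'\le 0$ with $0<a<b$, $0<a'<b'$, $l,l'\in\mathbb R$. Here $h_S(z,\xi)=S(z)h(z,\xi)$, $h_T(z,\xi)=T(z)h(z,\xi)$, and, for $T=T_{a,b}-l$ and $w=T_{a,b}(u)$, $$\langle g(u,DT(u)),\phi\rangle=\int\phi\, g(w,\nabla w)\,dx+\int\phi\, g^0\big(\tilde w,\tfrac{Dw}{|Dw|}\big)\,d|D^cw|+\sum_{x\in J_w}\phi(x)\int_{w_-(x)}^{w_+(x)}g^0(s,\nu_w(x))\,ds$$ $$\qquad+\int_{\{u\le a\}}\phi\,(g(u,0)-g(a,0))\,dx+\int_{\{u\ge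 b\}}\phi\,(g(u,0)-g(b,0))\,dx ,$$ with recession function $g^0(z,\xi)=\lim_{t\to0^+}t\,g(z,\xi/t)$; $\nabla w$, $D^cw$ are the absolutely continuous density and the Cantor part of $Dw$, $\tilde w$ is the approximate limit, $J_w$ the set of approximate jump points, $w_-<w_+$ the one-sided approximate limits there, and $\nu_w$ the sign of the jump. **Proposition.** Let $\delta>0$, $k\in\mathbb R$, and let $v\in C^2(-\delta,\delta)$ be nonnegative and such that 1. $\lim_{x\to\delta}v(x)=\lim_{x\to\delta}v'(x)=0$; 2. $\lim_{x\to-\delta}v(x)=\lim_{x\to-\delta}v'(x)=0$; 3. $x\,v'(x)<0$ for $x\in(-\delta,\delta)\setminus\{0\}$; 4. $v''(x)\le k$ for $x\in(-\delta,\delta)$. Let $u_0$ (understood up to null sets) satisfy $\operatorname{supp}u_0\subset[-\delta,\delta]$ and $0\le u_0\le v^{1/m}$ on $(-\delta,\delta)$. Then $k>0$, and the function $$\tilde u(t,x)=\Big(\frac{v(x)}{1-(2+m)\nu k t}\Big)^{1/m}\ (|x|<\delta),\qquad \tilde u(t,x)=0\ (|x|\ge\delta),$$ is a super-solution of the FLPME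 with initial datum $u_0$ for $t\in\big[0,\frac1{(2+m)\nu k}\big)$: it is an entropy super-solution in $Q_T$ for every $0<T<\frac1{(2+m)\nu k}$, and $u_0\le\tilde u(0,\cdot)$ a.e. Moreover its support is static: $\operatorname{supp}\tilde u(t,\cdot)=\operatorname{supp}\tilde u(0,\cdot)$ for all $t\in\big[0,\frac1{(2+m)\nu k}\big)$. (For $\nu=1$ the denominator is $1-(2+m)kt$.) -/

import Mathlib

open Set Filter Topology MeasureTheory
open scoped ContDiff

/-! ### Functions of locally bounded variation on the line -/

/-- `C_c^∞(ℝ)`. -/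
def IsTestFun (ψ : ℝ → ℝ) : Prop := ContDiff ℝ ∞ ψ ∧ HasCompactSupport ψ

/-- The distributional derivative of `w ∈ L¹_loc(ℝ)` is the (signed) Radon measure `p - n`, written
in its Jordan decomposition: `p`, `n` are mutually singular Radon measures and
`∫ w ψ' = - ∫ ψ d(p - n)` for every test function. Such a pair is unique. -/
structure IsBVDeriv (w : ℝ → ℝ) (p n : Measure ℝ) : Prop where
  locallyIntegrable : LocallyIntegrable w
  finite_pos : IsLocallyFiniteMeasure p
  finite_neg : IsLocallyFiniteMeasure n
  singular : p ⟂ₘ n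
  deriv_eq : ∀ ψ, IsTestFun ψ →
    ∫ x, w x * deriv ψ x = -(∫ x, ψ x ∂p - ∫ x, ψ x ∂n)

/-- `w ∈ BV_loc(ℝ)`. -/
def IsBVLoc (w : ℝ → ℝ) : Prop := ∃ pn : Measure ℝ × Measure ℝ, IsBVDeriv w pn.1 pn.2

/-- The Jordan pair `((Dw)⁺, (Dw)⁻)` of the derivative of `w ∈ BV_loc(ℝ)`. -/
noncomputable def bvPair (w : ℝ → ℝ) : Measure ℝ × Measure ℝ :=
  Classical.epsilon fun pn => IsBVDeriv w pn.1 pn.2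

/-- `(Dw)⁺`. -/
noncomputable def bvPos (w : ℝ → ℝ) : Measure ℝ := (bvPair w).1

/-- `(Dw)⁻`. -/
noncomputable def bvNeg (w : ℝ → ℝ) : Measure ℝ := (bvPair w).2

/-- `∇w`: the density of the absolutely continuous part of `Dw`. -/
noncomputable def bvGrad (w : ℝ → ℝ) (x : ℝ) : ℝ :=
  ((bvPos w).rnDeriv volume x).toReal - ((bvNeg w).rnDeriv volume x).toReal

/-- `l` is the approximate limit of `w` at `x` from the left. -/
def IsApproxLeft (w : ℝ → ℝ) (x l : ℝ) : Prop :=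
  Tendsto (fun ρ : ℝ => ρ⁻¹ * ∫ y in Ioo (x - ρ) x, |w y - l|) (𝓝[>] 0) (𝓝 0)

/-- `r` is the approximate limit of `w` at `x` from the right. -/
def IsApproxRight (w : ℝ → ℝ) (x r : ℝ) : Prop :=
  Tendsto (fun ρ : ℝ => ρ⁻¹ * ∫ y in Ioo x (x + ρ), |w y - r|) (𝓝[>] 0) (𝓝 0)

/-- `J_w`: the approximate jump points of `w`. -/
def jumpSet (w : ℝ → ℝ) : Set ℝ :=
  {x | ∃ l r, l ≠ r ∧ IsApproxLeft w x l ∧ IsApproxRight w x r}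

/-- The approximate left limit of `w` at `x`. -/
noncomputable def approxLeft (w : ℝ → ℝ) (x : ℝ) : ℝ := Classical.epsilon (IsApproxLeft w x)

/-- The approximate right limit of `w` at `x`. -/
noncomputable def approxRight (w : ℝ → ℝ) (x : ℝ) : ℝ := Classical.epsilon (IsApproxRight w x)

/-- `w̃(x)`: the approximate limit of `w` at `x`. -/
noncomputable def approxLim (w : ℝ → ℝ) (x : ℝ) : ℝ :=
  Classical.epsilon fun l => IsApproxLeft w x l ∧ IsApproxRight w x l

/-! ### Functionals of `(w, Dw)` -/

/-- The recession function `g⁰(z, ξ) = lim_{t → 0⁺} t g(z, ξ / t)`. -/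
noncomputable def recession (g : ℝ → ℝ → ℝ) (z ξ : ℝ) : ℝ :=
  limUnder (𝓝[>] (0 : ℝ)) fun t => t * g z (ξ / t)

/-- The functional `𝓡_{φ g}(w)` for `w ∈ BV_loc(ℝ)`, bounded, and `φ` of compact support:
an absolutely continuous part, a Cantor part (where `Dw / |Dw|` is `1` for `(Dw)⁺` and `-1` for
`(Dw)⁻`), and a jump part (where the direction is the sign of the jump). -/
noncomputable def dalMaso (g : ℝ → ℝ → ℝ) (φ w : ℝ → ℝ) : ℝ :=
  (∫ x, φ x * g (w x) (bvGrad w x))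
  + (∫ x in (jumpSet w)ᶜ, φ x * recession g (approxLim w x) 1 ∂((bvPos w).singularPart volume))
  + (∫ x in (jumpSet w)ᶜ, φ x * recession g (approxLim w x) (-1) ∂((bvNeg w).singularPart volume))
  + ∑' x : jumpSet w, φ x *
      ∫ s in (min (approxLeft w x) (approxRight w x))..(max (approxLeft w x) (approxRight w x)),
        recession g s (SignType.sign (approxRight w x - approxLeft w x) : ℝ)

/-- `T_{a,b}(r) = max(min(b, r), a)`. -/
noncomputable def trunc (a b r : ℝ) : ℝ := max (min b r) a

/-- `⟨g(u, D T_{a,b}(u)), φ⟩`. It depends on `T = T_{a,b} - l` only through `a` and `b`. -/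
noncomputable def truncPairing (g : ℝ → ℝ → ℝ) (a b : ℝ) (u φ : ℝ → ℝ) : ℝ :=
  dalMaso g φ (fun x => trunc a b (u x))
  + (∫ x in {x | u x ≤ a}, φ x * (g (u x) 0 - g a 0))
  + ∫ x in {x | b ≤ u x}, φ x * (g (u x) 0 - g b 0)

/-- `g` is the generalized gradient of `u ≥ 0`: for all `0 < a < b`,
`∇ T_{a,b}(u) = g χ_{a < u < b}` almost everywhere. It is determined a.e. on `{u > 0}`. -/
def IsTruncGrad (u g : ℝ → ℝ) : Prop :=
  ∀ a b, 0 < a → a < b →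
    bvGrad (fun x => trunc a b (u x)) =ᵐ[volume] {x | a < u x ∧ u x < b}.indicator g

/-- `∇u` for a function `u ≥ 0` all of whose truncations are in `BV_loc`. -/
noncomputable def truncGrad (u : ℝ → ℝ) : ℝ → ℝ := Classical.epsilon (IsTruncGrad u)

/-! ### The flux-limited porous medium equation -/

/-- The flux `𝐚(z, ξ)`, `z ≥ 0`, of `u_t = 𝐚(u, u_x)_x`, which is the equation
`u_t = ν ( u (u^m)_x / √(1 + (ν²/c²) (u^m)_x²) )_x` after `(u^m)_x = m u^{m-1} u_x`. -/
noncomputable def flux (m ν c z ξ : ℝ) : ℝ :=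
  ν * (m * z ^ m * ξ) / √(1 + (ν / c) ^ 2 * (m * z ^ (m - 1) * ξ) ^ 2)

/-- `h(z, ξ) = 𝐚(z, ξ) ξ`. -/
noncomputable def fluxEnergy (m ν c z ξ : ℝ) : ℝ := flux m ν c z ξ * ξ

/-- `w ∈ L¹_{loc,w}(0, T; BV_loc(ℝ))`: weak-star measurability, and local integrability in time of
the norm of `BV(-R, R)` for every `R`. (Pairings with `Dw` are pairings of `w` with `ψ'`.) -/
structure MemL1LocBVLoc (T : ℝ) (w : ℝ → ℝ → ℝ) : Prop where
  bv : ∀ᵐ t ∂(volume.restrict (Ioo 0 T)), IsBVLoc (w t)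
  weakMeasurable : ∀ ψ, IsTestFun ψ →
    AEMeasurable (fun t => ∫ x, w t x * ψ x) (volume.restrict (Ioo 0 T))
  norm_integrable : ∀ R t₁ t₂, 0 < R → 0 < t₁ → t₁ < t₂ → t₂ < T →
    ∫⁻ t in Ioo t₁ t₂, ((∫⁻ x in Ioo (-R) R, ‖w t x‖ₑ)
      + (bvPos (w t) + bvNeg (w t)) (Ioo (-R) R)) < ⊤

/-- The left-hand integrand (in time) of the entropy inequality,
`⟨h_S(u, D T(u)), φ⟩ + ⟨h_T(u, D S(u)), φ⟩`, with `T = T_{a,b} - l` and `S = T_{a',b'} - l'`. -/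
noncomputable def entropyLHS (m ν c a b l a' b' l' : ℝ) (u φ : ℝ → ℝ) : ℝ :=
  truncPairing (fun z ξ => (trunc a' b' z - l') * fluxEnergy m ν c z ξ) a b u φ
  + truncPairing (fun z ξ => (trunc a b z - l) * fluxEnergy m ν c z ξ) a' b' u φ

/-- The right-hand integrand (in time) of the entropy inequality,
`∫ (J_{TS}(u) φ_t - 𝐚(u, ∇u) φ_x T(u) S(u)) dx`, where `J_q(r) = ∫_0^r q`. -/
noncomputable def entropyRHS (m ν c a b l a' b' l' : ℝ) (u φt φx : ℝ → ℝ) : ℝ :=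
  ∫ x, ((∫ s in (0 : ℝ)..(u x), (trunc a b s - l) * (trunc a' b' s - l')) * φt x
    - flux m ν c (u x) (truncGrad u x) * φx x
        * ((trunc a b (u x) - l) * (trunc a' b' (u x) - l')))

/-- `u` is an entropy super-solution of the flux-limited porous medium equation in
`Q_T = (0, T) × ℝ`; `u t x` is the value at time `t` and position `x`. -/
structure IsEntropySuperSolution (m ν c T : ℝ) (u : ℝ → ℝ → ℝ) : Prop where
  measurable : AEMeasurable (fun q : ℝ × ℝ => u q.1 q.2) (volume.restrict (Ioo 0 T ×ˢ univ))
  nonneg : ∀ t ∈ Ioo 0 T, ∀ x, 0 ≤ u t x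
  integrable : ∀ t ∈ Icc 0 T, Integrable (u t)
  continuous_L1 : ∀ t₀ ∈ Icc 0 T,
    Tendsto (fun t => ∫ x, |u t x - u t₀ x|) (𝓝[Icc 0 T] t₀) (𝓝 0)
  trunc_bv : ∀ a b, 0 < a → a < b → MemL1LocBVLoc T fun t x => trunc a b (u t x) - a
  flux_bounded : ∀ᵐ t ∂(volume.restrict (Ioo 0 T)), ∀ R : ℝ, ∃ C : ℝ,
    ∀ᵐ x ∂(volume.restrict (Ioo (-R) R)), |flux m ν c (u t x) (truncGrad (u t) x)| ≤ C
  entropy : ∀ φ : ℝ × ℝ → ℝ, ContDiff ℝ ∞ φ → HasCompactSupport φ →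
    tsupport φ ⊆ Ioo 0 T ×ˢ univ → (∀ q, 0 ≤ φ q) →
    -- `T = T_{a,b} - l ≥ 0`
    ∀ a b l : ℝ, 0 < a → a < b → (∀ r, 0 ≤ trunc a b r - l) →
    -- `S = T_{a',b'} - l' ≤ 0`
    ∀ a' b' l' : ℝ, 0 < a' → a' < b' → (∀ r, trunc a' b' r - l' ≤ 0) →
    IntegrableOn (fun t => entropyLHS m ν c a b l a' b' l' (u t) (fun x => φ (t, x))) (Ioo 0 T) ∧
    IntegrableOn (fun t => entropyRHS m ν c a b l a' b' l' (u t)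
      (fun x => deriv (fun s => φ (s, x)) t) (fun x => deriv (fun y => φ (t, y)) x)) (Ioo 0 T) ∧
    ∫ t in Ioo 0 T, entropyLHS m ν c a b l a' b' l' (u t) (fun x => φ (t, x)) ≤
    ∫ t in Ioo 0 T, entropyRHS m ν c a b l a' b' l' (u t)
      (fun x => deriv (fun s => φ (s, x)) t) (fun x => deriv (fun y => φ (t, y)) x)

/-- `(v(x) / (1 - (2 + m) ν k t))^{1/m}` for `x ∈ (-δ, δ)`, extended by zero. -/
noncomputable def separatedProfile (m ν k δ : ℝ) (v : ℝ → ℝ) (t : ℝ) : ℝ → ℝ :=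
  (Ioo (-δ) δ).indicator fun x => (v x / (1 - (2 + m) * ν * k * t)) ^ (1 / m)

/-!
The function `ũ` has pressure `ũ ^ m = s(t) V(x)`, where `V` is `v` extended by zero and
`s(t) = (1 - (2 + m) ν k t)⁻¹` solves `s' = (2 + m) ν k s²`. Hence `ũ_t = ν s k (2 + m) / m ũ`.

For a fixed time let `V` stand for the pressure, `D` for its derivative and `K` for the bound on the
second derivative. The flux is `ν u D / √(1 + κ D²)`, and its derivative is at most
`ν (u_x D + u K)`, since the square root is at least one. As `V` and `D` vanish at the left end of the
support, `(2 K V - D²)' = 2 D (K - D') ≥ 0` where `V` increases gives `D² ≤ 2 K V`; the argument at the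
right end is the same. Then `u_x D = u D² / (m V) ≤ 2 K u / m`, and the derivative of the flux is at
most `ν K (2 + m) / m u`, which is exactly `u_t` (`IsBump.exists_hasDerivAt_pressureFlux`,
`IsBump.hasDerivAt_density_time`).

To pass from this pointwise inequality to the entropy inequality, note that a truncation of `u` at a
positive level is continuous and differentiable off a countable set with bounded derivative. So its
distributional derivative is absolutely continuous, with neither Cantor nor jump part
(`isBVDeriv_of_hasDerivAt`, `dalMaso_eq_integral`); the Jordan pair in the definitions is this one
because such pairs are unique (`IsBVDeriv.unique`). The pairings become integrals
of `φ a(u, u_x) (T(u) S(u))_x`, and the inequality tested with `- φ T(u) S(u) ≥ 0` is integrated by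
parts in space (`IsBump.entropy_inequality`). No boundary terms arise, since the flux vanishes
continuously at `±δ`: the extension by zero does not create mass at the boundary of the support. An
integration by parts in time of `J_{TS}(u)` finishes the proof (`IsBump.entropy_spacetime`).
-/

/-! ### Derivatives of functions of locally bounded variation -/

/-- A Radon measure on the line is determined by its action on test functions: the indicator of
`(a, b]` is the bounded pointwise limit of `x ↦ σ (n (x - a)) (1 - σ (n (x - b)))`, where `σ` is a
smooth transition from `0` on `(-∞, 0]` to `1` on `[1, ∞)`. -/
theorem measure_ext_of_integral_testFun {μ ν : Measure ℝ} [IsLocallyFiniteMeasure μ]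
    [IsLocallyFiniteMeasure ν] (h : ∀ ψ, IsTestFun ψ → ∫ x, ψ x ∂μ = ∫ x, ψ x ∂ν) : μ = ν := by
  refine Measure.ext_of_Ioc μ ν fun a b hab => ?_
  set σ := Real.smoothTransition with hσ
  let ψ : ℕ → ℝ → ℝ := fun n x => σ ((n + 1) * (x - a)) * (1 - σ ((n + 1) * (x - b)))
  have hzero : ∀ n x, x ∉ Icc a (b + 1) → ψ n x = 0 := by
    intro n x hx
    have hn : (0 : ℝ) < n + 1 := by positivity
    by_cases hxa : x < a
    · have : σ ((n + 1) * (x - a)) = 0 :=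
        Real.smoothTransition.zero_of_nonpos (by nlinarith)
      simp [ψ, this]
    · have hxb : b + 1 < x := by
        by_contra hc
        exact hx ⟨not_lt.1 hxa, not_lt.1 hc⟩
      have : σ ((n + 1) * (x - b)) = 1 :=
        Real.smoothTransition.one_of_one_le (by
          have : (0 : ℝ) ≤ n := by positivity
          nlinarith)
      simp [ψ, this]
  have hcd : ∀ n, ContDiff ℝ ∞ (ψ n) := by
    intro n
    have h1 : ContDiff ℝ ∞ σ := Real.smoothTransition.contDiff
    exact (h1.comp (by fun_prop)).mul (contDiff_const.sub (h1.comp (by fun_prop)))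
  have htest : ∀ n, IsTestFun (ψ n) := fun n =>
    ⟨hcd n, HasCompactSupport.intro isCompact_Icc (hzero n)⟩
  have hlim : ∀ x, Tendsto (fun n => ψ n x) atTop (𝓝 ((Ioc a b).indicator 1 x)) := by
    intro x
    have hbig : ∀ y : ℝ, 0 < y → ∀ᶠ n : ℕ in atTop, σ ((n + 1) * y) = 1 := by
      intro y hy
      obtain ⟨N, hN⟩ := exists_nat_gt (1 / y)
      filter_upwards [eventually_ge_atTop N] with n hn
      refine Real.smoothTransition.one_of_one_le ?_
      have : (N : ℝ) ≤ n := by exact_mod_cast hn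
      rw [div_lt_iff₀ hy] at hN
      nlinarith
    have hsmall : ∀ y : ℝ, y ≤ 0 → ∀ n : ℕ, σ ((n + 1) * y) = 0 := by
      intro y hy n
      refine Real.smoothTransition.zero_of_nonpos ?_
      have : (0 : ℝ) ≤ n := by positivity
      nlinarith
    refine tendsto_const_nhds.congr' ?_
    by_cases hxa : a < x
    · by_cases hxb : x ≤ b
      · filter_upwards [hbig (x - a) (by linarith)] with n hn
        simp [ψ, hn, hsmall (x - b) (by linarith) n, indicator, hxa, hxb]
      · filter_upwards [hbig (x - b) (by linarith)] with n hn
        simp [ψ, hn, indicator, hxb]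
    · refine Eventually.of_forall fun n => ?_
      simp [ψ, hsmall (x - a) (by linarith) n, indicator, hxa]
  have key : ∀ (κ : Measure ℝ) [IsLocallyFiniteMeasure κ],
      Tendsto (fun n => ∫ x, ψ n x ∂κ) atTop (𝓝 (κ.real (Ioc a b))) := by
    intro κ _
    have h1 : ∫ x, (Ioc a b).indicator (1 : ℝ → ℝ) x ∂κ = κ.real (Ioc a b) :=
      integral_indicator_one measurableSet_Ioc
    rw [← h1]
    refine tendsto_integral_of_dominated_convergence ((Icc a (b + 1)).indicator 1)
      (fun n => (hcd n).continuous.aestronglyMeasurable) ?_ ?_ (Eventually.of_forall hlim)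
    · exact (integrable_indicator_iff measurableSet_Icc).2
        (integrableOn_const isCompact_Icc.measure_lt_top.ne)
    · intro n
      refine Eventually.of_forall fun x => ?_
      by_cases hx : x ∈ Icc a (b + 1)
      · have e1 := Real.smoothTransition.nonneg ((n + 1) * (x - a))
        have e2 := Real.smoothTransition.le_one ((n + 1) * (x - a))
        have e3 := Real.smoothTransition.nonneg ((n + 1) * (x - b))
        have e4 := Real.smoothTransition.le_one ((n + 1) * (x - b))
        rw [indicator_of_mem hx, Real.norm_eq_abs, abs_of_nonneg (mul_nonneg e1 (by linarith))]
        exact mul_le_one₀ e2 (by linarith) (by linarith)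
      · simp [hzero n x hx, hx]
  have h2 : μ.real (Ioc a b) = ν.real (Ioc a b) := by
    refine tendsto_nhds_unique (key μ) ((key ν).congr fun n => (h _ (htest n)).symm)
  rwa [measureReal_def, measureReal_def,
    ENNReal.toReal_eq_toReal_iff' measure_Ioc_lt_top.ne measure_Ioc_lt_top.ne] at h2

/-- One half of the uniqueness of the Jordan decomposition, for measures that need not be finite. -/
theorem measure_le_of_add_eq_add {p n p' n' : Measure ℝ} (h : p ⟂ₘ n)
    (he : p + n' = p' + n) : p ≤ p' := by
  obtain ⟨A, hA, hpA, hnA⟩ := h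
  refine Measure.le_iff.2 fun B hB => ?_
  have h1 : (p + n') (B ∩ Aᶜ) = (p' + n) (B ∩ Aᶜ) := by rw [he]
  rw [Measure.add_apply, Measure.add_apply, measure_mono_null inter_subset_right hnA,
    add_zero] at h1
  calc p B = p (B ∩ A) + p (B ∩ Aᶜ) := (measure_inter_add_sdiff B hA).symm
    _ = p (B ∩ Aᶜ) := by rw [measure_mono_null inter_subset_right hpA, zero_add]
    _ ≤ p (B ∩ Aᶜ) + n' (B ∩ Aᶜ) := le_self_add
    _ = p' (B ∩ Aᶜ) := h1
    _ ≤ p' B := measure_mono inter_subset_left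

theorem isLocallyFiniteMeasure_add (μ ν : Measure ℝ) [IsLocallyFiniteMeasure μ]
    [IsLocallyFiniteMeasure ν] : IsLocallyFiniteMeasure (μ + ν) := by
  refine ⟨fun x => ?_⟩
  obtain ⟨s, hs, hμ⟩ := μ.finiteAt_nhds x
  obtain ⟨t, ht, hν⟩ := ν.finiteAt_nhds x
  refine ⟨s ∩ t, inter_mem hs ht, ?_⟩
  rw [Measure.add_apply]
  exact ENNReal.add_lt_top.2 ⟨(measure_mono inter_subset_left).trans_lt hμ,
    (measure_mono inter_subset_right).trans_lt hν⟩

theorem IsBVDeriv.unique {w : ℝ → ℝ} {p n p' n' : Measure ℝ} (h : IsBVDeriv w p n)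
    (h' : IsBVDeriv w p' n') : p = p' ∧ n = n' := by
  have := h.finite_pos
  have := h.finite_neg
  have := h'.finite_pos
  have := h'.finite_neg
  have he : p + n' = p' + n := by
    have hlf := isLocallyFiniteMeasure_add p n'
    have hlf' := isLocallyFiniteMeasure_add p' n
    refine measure_ext_of_integral_testFun fun ψ hψ => ?_
    have hi : ∀ (κ : Measure ℝ) [IsLocallyFiniteMeasure κ], Integrable ψ κ := fun κ _ =>
      hψ.1.continuous.integrable_of_hasCompactSupport hψ.2
    rw [integral_add_measure (hi _) (hi _), integral_add_measure (hi _) (hi _)]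
    have e := (h.deriv_eq ψ hψ).symm.trans (h'.deriv_eq ψ hψ)
    linarith
  have he' : n + p' = n' + p := by rw [add_comm n, add_comm n', he]
  exact ⟨le_antisymm (measure_le_of_add_eq_add h.singular he)
      (measure_le_of_add_eq_add h'.singular he.symm),
    le_antisymm (measure_le_of_add_eq_add h.singular.symm he')
      (measure_le_of_add_eq_add h'.singular.symm he'.symm)⟩

theorem IsBVDeriv.bvPair_eq {w : ℝ → ℝ} {p n : Measure ℝ} (h : IsBVDeriv w p n) :
    bvPos w = p ∧ bvNeg w = n :=
  (Classical.epsilon_spec (p := fun pn : Measure ℝ × Measure ℝ => IsBVDeriv w pn.1 pn.2)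
    ⟨(p, n), h⟩).unique h

/-- A continuous function with a derivative `w'` off a countable set, where `w'` is integrable, is
a primitive of `w'`, so that its distributional derivative has density `w'`. -/
theorem isBVDeriv_of_hasDerivAt {w w' : ℝ → ℝ} {E : Set ℝ} (hE : E.Countable) (hw : Continuous w)
    (hd : ∀ x ∉ E, HasDerivAt w (w' x) x) (hm : Measurable w') (hi : Integrable w') :
    IsBVDeriv w (volume.withDensity fun x => ENNReal.ofReal (w' x))
      (volume.withDensity fun x => ENNReal.ofReal (-w' x)) where
  locallyIntegrable := hw.locallyIntegrable
  finite_pos := by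
    have := isFiniteMeasure_withDensity_ofReal hi.2
    infer_instance
  finite_neg := by
    have := isFiniteMeasure_withDensity_ofReal hi.neg.2
    simpa using! (inferInstance : IsLocallyFiniteMeasure
      (volume.withDensity fun x => ENNReal.ofReal ((-w') x)))
  singular := withDensity_ofReal_mutuallySingular hm
  deriv_eq := by
    intro ψ hψ
    have hψc : Continuous ψ := hψ.1.continuous
    have hψ'c : Continuous (deriv ψ) := hψ.1.continuous_deriv (by norm_cast)
    have hψd : ∀ x, HasDerivAt ψ (deriv ψ x) x := fun x =>
      (hψ.1.differentiable (by simp) x).hasDerivAt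
    obtain ⟨C, hC⟩ := hψ.2.exists_bound_of_continuous hψc
    have hi1 : Integrable fun x => w x * deriv ψ x :=
      (hw.mul hψ'c).integrable_of_hasCompactSupport hψ.2.deriv.mul_left
    have hi2 : Integrable fun x => w' x * ψ x :=
      hi.mul_bdd hψc.aestronglyMeasurable (Eventually.of_forall hC)
    obtain ⟨R, hR⟩ : ∃ R : ℝ, tsupport ψ ⊆ Ioo (-R) R := by
      obtain ⟨R, hR⟩ := hψ.2.isCompact.isBounded.subset_ball_lt 0 0
      exact ⟨R, by simpa [Real.ball_eq_Ioo] using hR.2⟩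
    have hz : ∀ x, x ∉ Ioc (-|R|) |R| → w' x * ψ x + w x * deriv ψ x = 0 := by
      intro x hx
      have hx' : x ∉ tsupport ψ := fun hxs => hx
        ⟨(neg_le_neg (le_abs_self R)).trans_lt (hR hxs).1, (hR hxs).2.le.trans (le_abs_self R)⟩
      have h2 : deriv ψ x = 0 := by
        by_contra hne
        exact hx' (support_deriv_subset hne)
      rw [image_eq_zero_of_notMem_tsupport hx', h2]
      simp
    have hsum : ∫ x, (w' x * ψ x + w x * deriv ψ x) = 0 := by
      rw [← setIntegral_eq_integral_of_forall_compl_eq_zero hz,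
        ← intervalIntegral.integral_of_le (by linarith [abs_nonneg R]),
        integral_eq_of_hasDerivAt_off_countable (fun x => w x * ψ x) _ hE
          (hw.mul hψc).continuousOn (fun x hx => (hd x hx.2).mul (hψd x))
          (hi2.add hi1).intervalIntegrable]
      have hb : ∀ y, (y = |R| ∨ y = -|R|) → ψ y = 0 := by
        intro y hy
        refine image_eq_zero_of_notMem_tsupport fun hys => ?_
        have := hR hys
        rcases hy with rfl | rfl
        · exact absurd this.2 (not_lt.2 (le_abs_self R))
        · exact absurd this.1 (not_lt.2 (neg_le_neg (le_abs_self R)))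
      simp [hb]
    rw [integral_add hi2 hi1] at hsum
    have hp : ∀ f : ℝ → ℝ, Measurable f →
        ∫ x, ψ x ∂(volume.withDensity fun x => ENNReal.ofReal (f x)) =
          ∫ x, max (f x) 0 * ψ x := by
      intro f hf
      rw [integral_withDensity_eq_integral_toReal_smul hf.ennreal_ofReal
        (Eventually.of_forall fun x => ENNReal.ofReal_lt_top)]
      simp [ENNReal.toReal_ofReal', smul_eq_mul]
    have hbd : ∀ f : ℝ → ℝ, Integrable f → Integrable fun x => max (f x) 0 * ψ x := fun f hf =>
      hf.pos_part.mul_bdd hψc.aestronglyMeasurable (Eventually.of_forall hC)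
    have hneg : Integrable fun x => max (-w' x) 0 * ψ x := hbd (fun x => -w' x) hi.neg
    rw [hp _ hm, hp (fun x => -w' x) hm.neg, ← integral_sub (hbd _ hi) hneg]
    have : ∀ x, max (w' x) 0 * ψ x - max (-w' x) 0 * ψ x = w' x * ψ x := by
      intro x
      rw [← sub_mul, max_zero_sub_max_neg_zero_eq_self]
    simp_rw [this]
    linarith

theorem tendsto_average_of_continuous {f : ℝ → ℝ} (hf : Continuous f) (x : ℝ) :
    Tendsto (fun ρ : ℝ => ρ⁻¹ * ∫ y in Ioo (x - ρ) x, f y) (𝓝[>] 0) (𝓝 (f x)) ∧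
    Tendsto (fun ρ : ℝ => ρ⁻¹ * ∫ y in Ioo x (x + ρ), f y) (𝓝[>] 0) (𝓝 (f x)) := by
  have h := hasDerivAt_iff_tendsto_slope_zero.1
    (intervalIntegral.integral_hasDerivAt_right (hf.intervalIntegrable x x)
      (hf.stronglyMeasurableAtFilter _ _) hf.continuousAt)
  simp only [intervalIntegral.integral_same, sub_zero, smul_eq_mul] at h
  constructor
  · have hneg : Tendsto (fun ρ : ℝ => -ρ) (𝓝[>] 0) (𝓝[≠] 0) :=
      tendsto_nhdsWithin_iff.2 ⟨by
        simpa using (tendsto_id.neg : Tendsto (fun ρ : ℝ => -ρ) (𝓝 0) _).mono_left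
          nhdsWithin_le_nhds, by
        filter_upwards [self_mem_nhdsWithin] with ρ hρ using neg_ne_zero.2 (ne_of_gt hρ)⟩
    refine (h.comp hneg).congr' ?_
    filter_upwards [self_mem_nhdsWithin] with ρ hρ
    have hρ' : 0 < ρ := hρ
    rw [← integral_Ioc_eq_integral_Ioo, ← intervalIntegral.integral_of_le (by linarith),
      Function.comp_apply, intervalIntegral.integral_symm, inv_neg, neg_mul_neg, ← sub_eq_add_neg]
  · refine (h.mono_left (nhdsWithin_mono _ fun y hy => ne_of_gt hy)).congr' ?_
    filter_upwards [self_mem_nhdsWithin] with ρ hρ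
    have hρ' : 0 < ρ := hρ
    rw [← integral_Ioc_eq_integral_Ioo, ← intervalIntegral.integral_of_le (by linarith)]

theorem jumpSet_eq_empty {w : ℝ → ℝ} (hw : Continuous w) : jumpSet w = ∅ := by
  refine eq_empty_of_forall_notMem ?_
  rintro x ⟨l, r, hne, hl, hr⟩
  have h1 := tendsto_nhds_unique hl
    (tendsto_average_of_continuous (f := fun y => |w y - l|) (by fun_prop) x).1
  have h2 := tendsto_nhds_unique hr
    (tendsto_average_of_continuous (f := fun y => |w y - r|) (by fun_prop) x).2
  exact hne ((sub_eq_zero.1 (abs_eq_zero.1 h1.symm)).symm.trans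
    (sub_eq_zero.1 (abs_eq_zero.1 h2.symm)))

theorem bvGrad_ae_eq {w w' : ℝ → ℝ} {E : Set ℝ} (hE : E.Countable) (hw : Continuous w)
    (hd : ∀ x ∉ E, HasDerivAt w (w' x) x) (hm : Measurable w') (hi : Integrable w') :
    bvGrad w =ᵐ[volume] w' := by
  obtain ⟨hp, hn⟩ := (isBVDeriv_of_hasDerivAt hE hw hd hm hi).bvPair_eq
  unfold bvGrad
  rw [hp, hn]
  filter_upwards [Measure.rnDeriv_withDensity volume hm.ennreal_ofReal,
    Measure.rnDeriv_withDensity volume hm.neg.ennreal_ofReal] with x h1 h2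
  simp only [Pi.neg_apply] at h2
  rw [h1, h2, ENNReal.toReal_ofReal', ENNReal.toReal_ofReal',
    max_zero_sub_max_neg_zero_eq_self]

/-- For a continuous primitive, `Dw` has neither a Cantor nor a jump part. -/
theorem dalMaso_eq_integral {w w' : ℝ → ℝ} {E : Set ℝ} (hE : E.Countable) (hw : Continuous w)
    (hd : ∀ x ∉ E, HasDerivAt w (w' x) x) (hm : Measurable w') (hi : Integrable w')
    (g : ℝ → ℝ → ℝ) (φ : ℝ → ℝ) :
    dalMaso g φ w = ∫ x, φ x * g (w x) (w' x) := by
  obtain ⟨hp, hn⟩ := (isBVDeriv_of_hasDerivAt hE hw hd hm hi).bvPair_eq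
  have hs : ∀ f : ℝ → ENNReal, (volume.withDensity f).singularPart volume = 0 := fun f =>
    Measure.singularPart_withDensity volume f
  have : IsEmpty (jumpSet w) := by
    rw [jumpSet_eq_empty hw]
    infer_instance
  unfold dalMaso
  rw [hp, hn, hs, hs, tsum_empty]
  simp only [Measure.restrict_zero, integral_zero_measure, add_zero]
  refine integral_congr_ae ?_
  filter_upwards [bvGrad_ae_eq hE hw hd hm hi] with x hx
  rw [hx]

/-! ### Compactly supported pressure profiles -/

/-- A pressure profile `V` (the function `u ^ m`) on the line, positive exactly on `(-δ, δ)`, with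
first and second derivatives `D` and `D'` there. `V` and `D` are extended by zero, and the extensions
are continuous. The bound `D ^ 2 ≤ 2 K V` is the consequence of `D' ≤ K` that controls the
logarithmic derivative of the pressure near the boundary of the support. -/
structure IsBump (δ K : ℝ) (V D D' : ℝ → ℝ) : Prop where
  delta_pos : 0 < δ
  continuous : Continuous V
  continuous_deriv : Continuous D
  eq_zero : ∀ x ∉ Ioo (-δ) δ, V x = 0
  deriv_eq_zero : ∀ x ∉ Ioo (-δ) δ, D x = 0
  pos : ∀ x ∈ Ioo (-δ) δ, 0 < V x
  hasDerivAt : ∀ x ∈ Ioo (-δ) δ, HasDerivAt V (D x) x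
  hasDerivAt_deriv : ∀ x ∈ Ioo (-δ) δ, HasDerivAt D (D' x) x
  continuousOn_deriv2 : ContinuousOn D' (Ioo (-δ) δ)
  deriv2_le : ∀ x ∈ Ioo (-δ) δ, D' x ≤ K
  sq_deriv_le : ∀ x, D x ^ 2 ≤ 2 * K * V x
  countable_level : ∀ a, 0 < a → {x | V x = a}.Countable

/-- The density `u` whose pressure `u ^ m` is `V`. -/
noncomputable def density (m : ℝ) (V : ℝ → ℝ) (x : ℝ) : ℝ := V x ^ (1 / m)

/-- The derivative of `density m V` on `{V > 0}` when `D` is the derivative of `V`. -/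
noncomputable def densityGrad (m : ℝ) (V D : ℝ → ℝ) (x : ℝ) : ℝ :=
  1 / m * density m V x ^ (1 - m) * D x

/-- The derivative of `trunc a b ∘ density m V` off the level sets `{u = a}` and `{u = b}`. -/
noncomputable def truncDensityGrad (m a b : ℝ) (V D : ℝ → ℝ) : ℝ → ℝ :=
  {x | a < density m V x ∧ density m V x < b}.indicator (densityGrad m V D)

/-- The function `ξ ↦ ξ / √(1 + κ ξ²)` that limits the flux. -/
noncomputable def limiter (κ ξ : ℝ) : ℝ := ξ / √(1 + κ * ξ ^ 2)

/-- The flux of `density m V` written in terms of the pressure gradient; unlike `densityGrad`, it is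
continuous up to the boundary of the support. -/
noncomputable def pressureFlux (m ν c : ℝ) (V D : ℝ → ℝ) (x : ℝ) : ℝ :=
  ν * density m V x * limiter ((ν / c) ^ 2) (D x)

theorem truncDensityGrad_of_mem {m a b : ℝ} {V D : ℝ → ℝ} {x : ℝ}
    (hx : a < density m V x ∧ density m V x < b) :
    truncDensityGrad m a b V D x = densityGrad m V D x :=
  indicator_of_mem (s := {x | a < density m V x ∧ density m V x < b}) hx _

theorem truncDensityGrad_of_not_mem {m a b : ℝ} {V D : ℝ → ℝ} {x : ℝ}
    (hx : ¬(a < density m V x ∧ density m V x < b)) : truncDensityGrad m a b V D x = 0 :=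
  indicator_of_notMem (s := {x | a < density m V x ∧ density m V x < b}) hx _

theorem abs_trunc_le {a b : ℝ} (ha : 0 < a) (hab : a < b) (r : ℝ) : |trunc a b r| ≤ b := by
  unfold trunc
  rw [abs_of_nonneg (ha.le.trans (le_max_right _ _))]
  exact max_le (min_le_left _ _) hab.le

theorem continuous_trunc (a b : ℝ) : Continuous (trunc a b) := by
  unfold trunc
  fun_prop

theorem trunc_of_mem {a b r : ℝ} (h : a < r ∧ r < b) : trunc a b r = r := by
  rw [trunc, min_eq_right h.2.le, max_eq_left h.1.le]

section Limiter

variable {κ : ℝ}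

theorem one_le_sqrt_one_add (hκ : 0 ≤ κ) (ξ : ℝ) : 1 ≤ √(1 + κ * ξ ^ 2) :=
  Real.one_le_sqrt.2 (by nlinarith [mul_nonneg hκ (sq_nonneg ξ)])

theorem hasDerivAt_limiter (hκ : 0 ≤ κ) (ξ : ℝ) :
    HasDerivAt (limiter κ) (1 / √(1 + κ * ξ ^ 2) ^ 3) ξ := by
  have h1 := one_le_sqrt_one_add hκ ξ
  have h0 : 0 < 1 + κ * ξ ^ 2 := by nlinarith [mul_nonneg hκ (sq_nonneg ξ)]
  have h2 : HasDerivAt (fun ξ => 1 + κ * ξ ^ 2) (κ * (2 * ξ)) ξ := by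
    simpa using ((hasDerivAt_pow 2 ξ).const_mul κ).const_add 1
  refine ((hasDerivAt_id' ξ).div (h2.sqrt h0.ne') (by positivity)).congr_deriv ?_
  have h3 : √(1 + κ * ξ ^ 2) ^ 2 = 1 + κ * ξ ^ 2 := Real.sq_sqrt h0.le
  have h4 : √(1 + κ * ξ ^ 2) ≠ 0 := by positivity
  field_simp
  rw [h3]
  ring

theorem continuous_limiter (hκ : 0 ≤ κ) : Continuous (limiter κ) :=
  continuous_iff_continuousAt.2 fun ξ => (hasDerivAt_limiter hκ ξ).continuousAt

theorem abs_limiter_le (hκ : 0 ≤ κ) (ξ : ℝ) : |limiter κ ξ| ≤ |ξ| := by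
  have h1 := one_le_sqrt_one_add hκ ξ
  rw [limiter, abs_div, abs_of_pos (zero_lt_one.trans_le h1)]
  exact div_le_self (abs_nonneg _) h1

theorem mul_limiter_le (hκ : 0 ≤ κ) (ξ : ℝ) : ξ * limiter κ ξ ≤ ξ ^ 2 :=
  calc ξ * limiter κ ξ ≤ |ξ * limiter κ ξ| := le_abs_self _
    _ = |ξ| * |limiter κ ξ| := abs_mul _ _
    _ ≤ |ξ| * |ξ| := mul_le_mul_of_nonneg_left (abs_limiter_le hκ ξ) (abs_nonneg ξ)
    _ = ξ ^ 2 := by rw [← pow_two, sq_abs]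

end Limiter

theorem integrable_of_bdd {f : ℝ → ℝ} {δ C : ℝ} (hf : Measurable f) (hC : ∀ x, |f x| ≤ C)
    (hz : ∀ x ∉ Ioo (-δ) δ, f x = 0) : Integrable f := by
  have h1 : IntegrableOn f (Ioo (-δ) δ) :=
    Measure.integrableOn_of_bounded measure_Ioo_lt_top.ne hf.aestronglyMeasurable
      (Eventually.of_forall hC)
  exact (integrableOn_iff_integrable_of_support_subset fun x hx => by
    by_contra hc
    exact hx (hz x hc)).1 h1

theorem integrable_of_eq_zero {f : ℝ → ℝ} {δ : ℝ} (hf : Continuous f)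
    (hz : ∀ x ∉ Ioo (-δ) δ, f x = 0) : Integrable f :=
  hf.integrable_of_hasCompactSupport (HasCompactSupport.intro (isCompact_Icc (a := -δ) (b := δ))
    fun x hx => hz x fun hx' => hx (Ioo_subset_Icc_self hx'))

namespace IsBump

variable {δ K m ν c : ℝ} {V D D' : ℝ → ℝ}

theorem smul (h : IsBump δ K V D D') {s : ℝ} (hs : 0 < s) :
    IsBump δ (s * K) (fun x => s * V x) (fun x => s * D x) (fun x => s * D' x) where
  delta_pos := h.delta_pos
  continuous := h.continuous.const_mul s
  continuous_deriv := h.continuous_deriv.const_mul s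
  eq_zero x hx := by simp [h.eq_zero x hx]
  deriv_eq_zero x hx := by simp [h.deriv_eq_zero x hx]
  pos x hx := mul_pos hs (h.pos x hx)
  hasDerivAt x hx := (h.hasDerivAt x hx).const_mul s
  hasDerivAt_deriv x hx := (h.hasDerivAt_deriv x hx).const_mul s
  continuousOn_deriv2 := h.continuousOn_deriv2.const_mul s
  deriv2_le x hx := mul_le_mul_of_nonneg_left (h.deriv2_le x hx) hs.le
  sq_deriv_le x := by
    have := mul_le_mul_of_nonneg_left (h.sq_deriv_le x) (sq_nonneg s)
    nlinarith
  countable_level a ha := by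
    convert h.countable_level (a / s) (by positivity) using 3 with x
    rw [eq_div_iff hs.ne', mul_comm]

theorem nonneg (h : IsBump δ K V D D') (x : ℝ) : 0 ≤ V x := by
  by_cases hx : x ∈ Ioo (-δ) δ
  · exact (h.pos x hx).le
  · exact (h.eq_zero x hx).ge

theorem K_nonneg (h : IsBump δ K V D D') : 0 ≤ K := by
  have h0 := h.pos 0 ⟨by linarith [h.delta_pos], h.delta_pos⟩
  by_contra hK
  nlinarith [h.sq_deriv_le 0, sq_nonneg (D 0), not_le.1 hK]

theorem density_nonneg (h : IsBump δ K V D D') (x : ℝ) : 0 ≤ density m V x :=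
  Real.rpow_nonneg (h.nonneg x) _

theorem density_pos (h : IsBump δ K V D D') {x : ℝ} (hx : x ∈ Ioo (-δ) δ) : 0 < density m V x :=
  Real.rpow_pos_of_pos (h.pos x hx) _

theorem density_eq_zero (h : IsBump δ K V D D') (hm : 1 ≤ m) {x : ℝ} (hx : x ∉ Ioo (-δ) δ) :
    density m V x = 0 := by
  rw [density, h.eq_zero x hx, Real.zero_rpow (by positivity)]

theorem density_rpow (h : IsBump δ K V D D') (hm : 1 ≤ m) (x : ℝ) : density m V x ^ m = V x := by
  rw [density, ← Real.rpow_mul (h.nonneg x), one_div_mul_cancel (by positivity), Real.rpow_one]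

theorem continuous_density (h : IsBump δ K V D D') (hm : 1 ≤ m) : Continuous (density m V) :=
  h.continuous.rpow_const fun _ => Or.inr (by positivity)

theorem hasDerivAt_density (h : IsBump δ K V D D') (hm : 1 ≤ m) {x : ℝ} (hx : x ∈ Ioo (-δ) δ) :
    HasDerivAt (density m V) (densityGrad m V D x) x := by
  have h1 := (h.hasDerivAt x hx).rpow_const (p := 1 / m) (Or.inl (h.pos x hx).ne')
  refine h1.congr_deriv ?_
  have : density m V x ^ (1 - m) = V x ^ (1 / m - 1) := by
    rw [density, ← Real.rpow_mul (h.nonneg x)]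
    congr 1
    field_simp
  unfold densityGrad
  rw [this]
  ring

theorem mem_Ioo_of_density_pos (h : IsBump δ K V D D') (hm : 1 ≤ m) {x : ℝ}
    (hx : 0 < density m V x) : x ∈ Ioo (-δ) δ := by
  by_contra hc
  exact hx.ne' (h.density_eq_zero hm hc)

theorem countable_density_level (h : IsBump δ K V D D') (hm : 1 ≤ m) {a : ℝ} (ha : 0 < a) :
    {x | density m V x = a}.Countable := by
  refine (h.countable_level (a ^ m) (Real.rpow_pos_of_pos ha _)).mono fun x hx => ?_
  have hx' : density m V x = a := hx
  simp only [mem_ofPred_eq, ← h.density_rpow hm x, hx']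

/-- The exceptional points are exactly the kinks of the truncated density: near the boundary of the
support the truncation from below at the level `a > 0` makes it constant. -/
theorem hasDerivAt_trunc_density (h : IsBump δ K V D D') (hm : 1 ≤ m) {a b : ℝ} (ha : 0 < a)
    (hab : a < b) {x : ℝ} (hxa : density m V x ≠ a) (hxb : density m V x ≠ b) :
    HasDerivAt (fun y => trunc a b (density m V y)) (truncDensityGrad m a b V D x) x := by
  have hc := (h.continuous_density hm).continuousAt (x := x)
  rcases lt_or_gt_of_ne hxa with h1 | h1
  · rw [truncDensityGrad_of_not_mem (fun hx => lt_asymm hx.1 h1)]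
    refine (hasDerivAt_const x a).congr_of_eventuallyEq ?_
    filter_upwards [hc.eventually_lt_const h1] with y hy
    rw [trunc, max_eq_right ((min_le_right _ _).trans hy.le)]
  · rcases lt_or_gt_of_ne hxb with h2 | h2
    · rw [truncDensityGrad_of_mem ⟨h1, h2⟩]
      refine (h.hasDerivAt_density hm
        (h.mem_Ioo_of_density_pos hm (ha.trans h1))).congr_of_eventuallyEq ?_
      filter_upwards [hc.eventually_lt_const h2, hc.eventually_const_lt h1] with y hy1 hy2
      exact trunc_of_mem ⟨hy2, hy1⟩
    · rw [truncDensityGrad_of_not_mem (fun hx => lt_asymm hx.2 h2)]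
      refine (hasDerivAt_const x b).congr_of_eventuallyEq ?_
      filter_upwards [hc.eventually_const_lt h2] with y hy
      rw [trunc, min_eq_left hy.le, max_eq_left hab.le]

theorem measurable_densityGrad (h : IsBump δ K V D D') (hm : 1 ≤ m) :
    Measurable (densityGrad m V D) := by
  have h1 := (h.continuous_density hm).measurable
  have h2 := h.continuous_deriv.measurable
  unfold densityGrad
  fun_prop

theorem measurable_truncDensityGrad (h : IsBump δ K V D D') (hm : 1 ≤ m) (a b : ℝ) :
    Measurable (truncDensityGrad m a b V D) := by
  have h1 := (h.continuous_density hm).measurable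
  exact (h.measurable_densityGrad hm).indicator
    ((measurableSet_lt measurable_const h1).inter (measurableSet_lt h1 measurable_const))

theorem abs_truncDensityGrad_le (h : IsBump δ K V D D') (hm : 1 ≤ m) {a b : ℝ} (ha : 0 < a)
    (x : ℝ) : |truncDensityGrad m a b V D x| ≤ 1 / m * a ^ (1 - m) * |D x| := by
  have ha' := Real.rpow_nonneg ha.le (1 - m)
  by_cases hx : a < density m V x ∧ density m V x < b
  · rw [truncDensityGrad_of_mem hx, densityGrad, abs_mul]
    have h1 := Real.rpow_nonneg (h.density_nonneg (m := m) x) (1 - m)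
    rw [abs_of_nonneg (by positivity : 0 ≤ 1 / m * density m V x ^ (1 - m))]
    refine mul_le_mul_of_nonneg_right (mul_le_mul_of_nonneg_left ?_ (by positivity)) (abs_nonneg _)
    exact Real.rpow_le_rpow_of_nonpos ha hx.1.le (by linarith)
  · rw [truncDensityGrad_of_not_mem hx, abs_zero]
    positivity

theorem truncDensityGrad_eq_zero (h : IsBump δ K V D D') {a b : ℝ} {x : ℝ}
    (hx : x ∉ Ioo (-δ) δ) : truncDensityGrad m a b V D x = 0 := by
  simp [truncDensityGrad, indicator, densityGrad, h.deriv_eq_zero x hx]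

theorem exists_deriv_bound (h : IsBump δ K V D D') : ∃ C, 0 ≤ C ∧ ∀ x, |D x| ≤ C := by
  obtain ⟨C, hC⟩ := (HasCompactSupport.intro isCompact_Icc fun x hx =>
    h.deriv_eq_zero x fun hx' => hx (Ioo_subset_Icc_self hx')).exists_bound_of_continuous
      h.continuous_deriv
  exact ⟨C, (norm_nonneg _).trans (hC 0), hC⟩

theorem integrable_truncDensityGrad (h : IsBump δ K V D D') (hm : 1 ≤ m) {a b : ℝ} (ha : 0 < a) :
    Integrable (truncDensityGrad m a b V D) := by
  obtain ⟨C, -, hC⟩ := h.exists_deriv_bound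
  have ha' := Real.rpow_nonneg ha.le (1 - m)
  refine integrable_of_bdd (h.measurable_truncDensityGrad hm a b)
    (C := 1 / m * a ^ (1 - m) * C) (fun x => ?_) (fun x => h.truncDensityGrad_eq_zero)
  refine (h.abs_truncDensityGrad_le hm ha x).trans ?_
  gcongr
  exact hC x

theorem countable_kinks (h : IsBump δ K V D D') (hm : 1 ≤ m) {a b : ℝ} (ha : 0 < a) (hb : 0 < b) :
    ({x | density m V x = a} ∪ {x | density m V x = b}).Countable :=
  (h.countable_density_level hm ha).union (h.countable_density_level hm hb)

theorem continuous_trunc_density (h : IsBump δ K V D D') (hm : 1 ≤ m) (a b : ℝ) :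
    Continuous fun x => trunc a b (density m V x) :=
  (continuous_trunc a b).comp (h.continuous_density hm)

theorem hasDerivAt_trunc_density_off_kinks (h : IsBump δ K V D D') (hm : 1 ≤ m) {a b : ℝ}
    (ha : 0 < a) (hab : a < b) :
    ∀ x ∉ {x | density m V x = a} ∪ {x | density m V x = b},
      HasDerivAt (fun y => trunc a b (density m V y)) (truncDensityGrad m a b V D x) x :=
  fun _ hx => h.hasDerivAt_trunc_density hm ha hab (fun he => hx (Or.inl he))
    (fun he => hx (Or.inr he))

theorem isTruncGrad (h : IsBump δ K V D D') (hm : 1 ≤ m) :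
    IsTruncGrad (density m V) (densityGrad m V D) := fun a b ha hab =>
  bvGrad_ae_eq (h.countable_kinks hm ha (ha.trans hab)) (h.continuous_trunc_density hm a b)
    (h.hasDerivAt_trunc_density_off_kinks hm ha hab) (h.measurable_truncDensityGrad hm a b)
    (h.integrable_truncDensityGrad hm ha)

/-- `{u > 0}` is the union of the sets `{1 / (n + 2) < u < n + 2}`, on each of which the generalized
gradient is determined almost everywhere. -/
theorem truncGrad_ae_eq (h : IsBump δ K V D D') (hm : 1 ≤ m) :
    ∀ᵐ x, 0 < density m V x → truncGrad (density m V) x = densityGrad m V D x := by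
  have hspec : IsTruncGrad (density m V) (truncGrad (density m V)) :=
    Classical.epsilon_spec ⟨_, h.isTruncGrad hm⟩
  have hall : ∀ᵐ x, ∀ n : ℕ,
      {x | 1 / ((n : ℝ) + 2) < density m V x ∧ density m V x < n + 2}.indicator
        (truncGrad (density m V)) x =
      {x | 1 / ((n : ℝ) + 2) < density m V x ∧ density m V x < n + 2}.indicator
        (densityGrad m V D) x := by
    refine ae_all_iff.2 fun n => ?_
    have hn : (0 : ℝ) ≤ n := by positivity
    have hab : 1 / ((n : ℝ) + 2) < n + 2 := by
      rw [div_lt_iff₀ (by positivity)]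
      nlinarith
    exact (hspec _ _ (by positivity) hab).symm.trans (h.isTruncGrad hm _ _ (by positivity) hab)
  filter_upwards [hall] with x hx hpos
  obtain ⟨n, hn⟩ := exists_nat_gt (max (density m V x) (1 / density m V x))
  have h1 : density m V x < n := (le_max_left _ _).trans_lt hn
  have h2 : 1 / density m V x < n := (le_max_right _ _).trans_lt hn
  have hmem : x ∈ {x | 1 / ((n : ℝ) + 2) < density m V x ∧ density m V x < n + 2} := by
    refine ⟨?_, by linarith⟩
    rw [div_lt_iff₀ (by positivity)]
    rw [div_lt_iff₀ hpos] at h2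
    nlinarith
  have := hx n
  rwa [indicator_of_mem hmem, indicator_of_mem hmem] at this

/-- The identities `m u ^ m u_x = u V_x` and `m u ^ (m - 1) u_x = V_x`. -/
theorem flux_densityGrad (hm : 1 ≤ m) {x : ℝ}
    (hx : 0 < density m V x) :
    flux m ν c (density m V x) (densityGrad m V D x) = pressureFlux m ν c V D x := by
  have hm0 : m ≠ 0 := by positivity
  have h1 : m * density m V x ^ m * densityGrad m V D x = density m V x * D x := by
    have : density m V x ^ m * density m V x ^ (1 - m) = density m V x := by
      rw [← Real.rpow_add hx, add_sub_cancel, Real.rpow_one]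
    calc m * density m V x ^ m * densityGrad m V D x
        = (m * (1 / m)) * (density m V x ^ m * density m V x ^ (1 - m)) * D x := by
          rw [densityGrad]; ring
      _ = _ := by rw [this, mul_one_div_cancel hm0, one_mul]
  have h2 : m * density m V x ^ (m - 1) * densityGrad m V D x = D x := by
    have : density m V x ^ (m - 1) * density m V x ^ (1 - m) = 1 := by
      rw [← Real.rpow_add hx, sub_add_sub_cancel, sub_self, Real.rpow_zero]
    calc m * density m V x ^ (m - 1) * densityGrad m V D x
        = (m * (1 / m)) * (density m V x ^ (m - 1) * density m V x ^ (1 - m)) * D x := by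
          rw [densityGrad]; ring
      _ = _ := by rw [this, mul_one_div_cancel hm0]; ring
  rw [flux, h1, h2, pressureFlux, limiter]
  ring

/-- Where `u = 0` the generalized gradient is undetermined, but the flux vanishes because
`0 ^ m = 0`. -/
theorem flux_truncGrad_ae_eq (h : IsBump δ K V D D') (hm : 1 ≤ m) :
    (fun x => flux m ν c (density m V x) (truncGrad (density m V) x)) =ᵐ[volume]
      pressureFlux m ν c V D := by
  filter_upwards [h.truncGrad_ae_eq hm] with x hx
  rcases (h.density_nonneg (m := m) x).eq_or_lt with h0 | h0
  · rw [pressureFlux, ← h0, flux, Real.zero_rpow (by positivity)]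
    simp
  · rw [hx h0, flux_densityGrad hm h0]

theorem continuous_pressureFlux (h : IsBump δ K V D D') (hm : 1 ≤ m) :
    Continuous (pressureFlux m ν c V D) :=
  ((h.continuous_density hm).const_mul ν).mul
    ((continuous_limiter (by positivity)).comp h.continuous_deriv)

theorem pressureFlux_eq_zero (h : IsBump δ K V D D') (hm : 1 ≤ m) {x : ℝ} (hx : x ∉ Ioo (-δ) δ) :
    pressureFlux m ν c V D x = 0 := by
  simp [pressureFlux, h.density_eq_zero hm hx]

/-- The spatial derivative `A'` of the flux, and the differential inequality behind the
super-solution property: `u_x V_x = u V_x ^ 2 / (m V) ≤ 2 K u / m` and `u V_xx ≤ K u`. -/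
theorem exists_hasDerivAt_pressureFlux (h : IsBump δ K V D D') (hm : 1 ≤ m) (hν : 0 < ν) :
    ∃ A' : ℝ → ℝ, ContinuousOn A' (Ioo (-δ) δ) ∧
      (∀ x ∈ Ioo (-δ) δ, HasDerivAt (pressureFlux m ν c V D) (A' x) x) ∧
      ∀ x ∈ Ioo (-δ) δ, A' x ≤ ν * K * (2 + m) / m * density m V x := by
  set κ := (ν / c) ^ 2 with hκ
  have hκ0 : 0 ≤ κ := by positivity
  have hm0 : 0 < m := by positivity
  refine ⟨fun x => ν * densityGrad m V D x * limiter κ (D x) +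
    ν * density m V x * (1 / √(1 + κ * D x ^ 2) ^ 3 * D' x), ?_, ?_, ?_⟩
  · have hg : ContinuousOn (densityGrad m V D) (Ioo (-δ) δ) :=
      (continuousOn_const.mul ((h.continuous_density hm).continuousOn.rpow_const
        fun x hx => Or.inl (h.density_pos hx).ne')).mul h.continuous_deriv.continuousOn
    have hl : Continuous fun x => limiter κ (D x) :=
      (continuous_limiter hκ0).comp h.continuous_deriv
    have hs : Continuous fun x => 1 / √(1 + κ * D x ^ 2) ^ 3 := by
      have := h.continuous_deriv
      refine continuous_const.div (by fun_prop) fun x => ?_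
      have := one_le_sqrt_one_add hκ0 (D x)
      positivity
    exact ((continuousOn_const.mul hg).mul hl.continuousOn).add
      ((continuousOn_const.mul (h.continuous_density hm).continuousOn).mul
        (hs.continuousOn.mul h.continuousOn_deriv2))
  · intro x hx
    exact ((h.hasDerivAt_density hm hx).const_mul ν).mul
      ((hasDerivAt_limiter hκ0 (D x)).comp x (h.hasDerivAt_deriv x hx))
  · intro x hx
    have hu := h.density_pos (m := m) hx
    have hV := h.pos x hx
    have hK := h.K_nonneg
    have h1 : densityGrad m V D x * limiter κ (D x) ≤ 2 * K / m * density m V x := by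
      have e : density m V x ^ (1 - m) = density m V x / V x := by
        rw [Real.rpow_sub hu, Real.rpow_one, h.density_rpow hm]
      have hcoef : 0 ≤ 1 / m * (density m V x / V x) := by positivity
      calc densityGrad m V D x * limiter κ (D x)
          = 1 / m * (density m V x / V x) * (D x * limiter κ (D x)) := by
            rw [densityGrad, e]; ring
        _ ≤ 1 / m * (density m V x / V x) * (2 * K * V x) :=
            mul_le_mul_of_nonneg_left
              ((mul_limiter_le hκ0 _).trans (h.sq_deriv_le x)) hcoef
        _ = _ := by field_simp
    have h2 : 1 / √(1 + κ * D x ^ 2) ^ 3 * D' x ≤ K := by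
      have hs := one_le_sqrt_one_add hκ0 (D x)
      have hs3 : 1 / √(1 + κ * D x ^ 2) ^ 3 ≤ 1 := by
        rw [div_le_one (by positivity)]
        exact one_le_pow₀ hs
      calc 1 / √(1 + κ * D x ^ 2) ^ 3 * D' x ≤ 1 / √(1 + κ * D x ^ 2) ^ 3 * K :=
            mul_le_mul_of_nonneg_left (h.deriv2_le x hx) (by positivity)
        _ ≤ 1 * K := by gcongr
        _ = K := one_mul K
    calc ν * densityGrad m V D x * limiter κ (D x) +
          ν * density m V x * (1 / √(1 + κ * D x ^ 2) ^ 3 * D' x)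
        = ν * (densityGrad m V D x * limiter κ (D x)) +
          ν * density m V x * (1 / √(1 + κ * D x ^ 2) ^ 3 * D' x) := by ring
      _ ≤ ν * (2 * K / m * density m V x) + ν * density m V x * K := by gcongr
      _ = _ := by field_simp

end IsBump

/-! ### The entropy inequality at a fixed time -/

/-- The product `T S` of the truncations `T = T_{a,b} - l` and `S = T_{a',b'} - l'`. -/
noncomputable def truncProd (a b l a' b' l' r : ℝ) : ℝ :=
  (trunc a b r - l) * (trunc a' b' r - l')

/-- The derivative of `T(u) S(u)`, `u = density m V`, off the kinks of the two truncations. -/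
noncomputable def truncProdGrad (m a b l a' b' l' : ℝ) (V D : ℝ → ℝ) (x : ℝ) : ℝ :=
  (trunc a' b' (density m V x) - l') * truncDensityGrad m a b V D x
    + (trunc a b (density m V x) - l) * truncDensityGrad m a' b' V D x

theorem continuous_truncProd (a b l a' b' l' : ℝ) : Continuous (truncProd a b l a' b' l') :=
  ((continuous_trunc a b).sub continuous_const).mul
    ((continuous_trunc a' b').sub continuous_const)

namespace IsBump

variable {δ K m ν c : ℝ} {V D D' : ℝ → ℝ}

theorem truncPairing_eq (h : IsBump δ K V D D') (hm : 1 ≤ m) {a b : ℝ} (ha : 0 < a) (hab : a < b)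
    (q φ : ℝ → ℝ) :
    truncPairing (fun z ξ => q z * fluxEnergy m ν c z ξ) a b (density m V) φ =
      ∫ x, φ x * q (density m V x) * pressureFlux m ν c V D x * truncDensityGrad m a b V D x := by
  have h0 : ∀ z, fluxEnergy m ν c z 0 = 0 := fun z => by simp [fluxEnergy]
  rw [truncPairing, dalMaso_eq_integral (h.countable_kinks hm ha (ha.trans hab))
    (h.continuous_trunc_density hm a b) (h.hasDerivAt_trunc_density_off_kinks hm ha hab)
    (h.measurable_truncDensityGrad hm a b) (h.integrable_truncDensityGrad hm ha)]
  simp only [h0, mul_zero, sub_self, integral_zero, add_zero]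
  congr 1 with x
  by_cases hx : a < density m V x ∧ density m V x < b
  · rw [trunc_of_mem hx, truncDensityGrad_of_mem hx, fluxEnergy,
      flux_densityGrad hm (ha.trans hx.1)]
    ring
  · rw [truncDensityGrad_of_not_mem hx, h0]
    simp

theorem integrable_pairing (h : IsBump δ K V D D') (hm : 1 ≤ m) {a b : ℝ} (ha : 0 < a)
    {q φ : ℝ → ℝ} (hq : Continuous q) (hφ : Continuous φ) :
    Integrable fun x =>
      φ x * q (density m V x) * pressureFlux m ν c V D x * truncDensityGrad m a b V D x := by
  have hc : Continuous fun x => φ x * q (density m V x) * pressureFlux m ν c V D x :=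
    (hφ.mul (hq.comp (h.continuous_density hm))).mul (h.continuous_pressureFlux hm)
  obtain ⟨C, hC⟩ := (HasCompactSupport.intro (isCompact_Icc (a := -δ) (b := δ)) fun x hx => by
    simp [h.pressureFlux_eq_zero (c := c) (ν := ν) hm
      fun hx' => hx (Ioo_subset_Icc_self hx')]).exists_bound_of_continuous hc
  exact (h.integrable_truncDensityGrad hm ha).bdd_mul hc.aestronglyMeasurable
    (Eventually.of_forall hC)

theorem entropyLHS_eq (h : IsBump δ K V D D') (hm : 1 ≤ m) {a b l a' b' l' : ℝ} (ha : 0 < a)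
    (hab : a < b) (ha' : 0 < a') (hab' : a' < b') {φ : ℝ → ℝ} (hφ : Continuous φ) :
    entropyLHS m ν c a b l a' b' l' (density m V) φ =
      ∫ x, φ x * pressureFlux m ν c V D x * truncProdGrad m a b l a' b' l' V D x := by
  rw [entropyLHS, h.truncPairing_eq hm ha hab (fun z => trunc a' b' z - l'),
    h.truncPairing_eq hm ha' hab' (fun z => trunc a b z - l), ← integral_add]
  · congr 1 with x
    rw [truncProdGrad]
    ring
  · exact h.integrable_pairing hm ha ((continuous_trunc a' b').sub continuous_const) hφ
  · exact h.integrable_pairing hm ha' ((continuous_trunc a b).sub continuous_const) hφ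

theorem integrable_entropyLHS (h : IsBump δ K V D D') (hm : 1 ≤ m) {a b l a' b' l' : ℝ}
    (ha : 0 < a) (ha' : 0 < a') {φ : ℝ → ℝ} (hφ : Continuous φ) :
    Integrable fun x =>
      φ x * pressureFlux m ν c V D x * truncProdGrad m a b l a' b' l' V D x := by
  refine ((h.integrable_pairing (ν := ν) (c := c) (b := b) hm ha
    ((continuous_trunc a' b').sub (continuous_const (y := l'))) hφ).add
    (h.integrable_pairing (ν := ν) (c := c) (b := b') hm ha'
    ((continuous_trunc a b).sub (continuous_const (y := l))) hφ)).congr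
    (Eventually.of_forall fun x => ?_)
  simp only [Pi.add_apply, Pi.sub_apply, truncProdGrad]
  ring

theorem entropyRHS_eq (h : IsBump δ K V D D') (hm : 1 ≤ m) (a b l a' b' l' : ℝ)
    (φt φx : ℝ → ℝ) :
    entropyRHS m ν c a b l a' b' l' (density m V) φt φx =
      ∫ x, ((∫ s in (0 : ℝ)..(density m V x), truncProd a b l a' b' l' s) * φt x
        - pressureFlux m ν c V D x * φx x * truncProd a b l a' b' l' (density m V x)) := by
  refine integral_congr_ae ?_
  filter_upwards [h.flux_truncGrad_ae_eq (ν := ν) (c := c) hm] with x hx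
  rw [hx]
  rfl

/-- The differential inequality `u_t ≥ a(u, u_x)_x` tested with `- φ T(u) S(u) ≥ 0` and integrated by
parts over the support. Only `a(u, u_x)_x ≤ ν K (2 + m) / m u` is available near `±δ`, so the
integration by parts is done on `[-β, β]` with `β < δ`, and the boundary terms vanish as `β → δ`
because the flux is continuous and vanishes at `±δ`. -/
theorem entropy_inequality (h : IsBump δ K V D D') (hm : 1 ≤ m) (hν : 0 < ν)
    {a b l a' b' l' : ℝ} (ha : 0 < a) (hab : a < b) (hl : ∀ r, 0 ≤ trunc a b r - l)
    (ha' : 0 < a') (hab' : a' < b') (hl' : ∀ r, trunc a' b' r - l' ≤ 0)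
    {φ φ' : ℝ → ℝ} (hφ : ∀ x, HasDerivAt φ (φ' x) x) (hφ' : Continuous φ') (hφ0 : ∀ x, 0 ≤ φ x) :
    ∫ x, (φ x * pressureFlux m ν c V D x * truncProdGrad m a b l a' b' l' V D x
        + pressureFlux m ν c V D x * φ' x * truncProd a b l a' b' l' (density m V x)) ≤
      ∫ x, -(ν * K * (2 + m) / m * density m V x
        * truncProd a b l a' b' l' (density m V x) * φ x) := by
  obtain ⟨A', hA'c, hA'd, hA'le⟩ := h.exists_hasDerivAt_pressureFlux (c := c) hm hν
  set A := pressureFlux m ν c V D with hA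
  set P := truncProdGrad m a b l a' b' l' V D with hP
  set Q : ℝ → ℝ := fun x => truncProd a b l a' b' l' (density m V x) with hQ
  set M := ν * K * (2 + m) / m with hM
  have hφc : Continuous φ := continuous_iff_continuousAt.2 fun x => (hφ x).continuousAt
  have hAc : Continuous A := h.continuous_pressureFlux hm
  have hQc : Continuous Q := (continuous_truncProd a b l a' b' l').comp (h.continuous_density hm)
  have huc := h.continuous_density hm
  have hQ0 : ∀ x, Q x ≤ 0 := fun x => mul_nonpos_of_nonneg_of_nonpos (hl _) (hl' _)
  have i1 : Integrable fun x => φ x * A x * P x := h.integrable_entropyLHS hm ha ha' hφc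
  have i2 : Integrable fun x => A x * φ' x * Q x :=
    integrable_of_eq_zero (δ := δ) (by fun_prop) fun x hx => by
      simp [hA, h.pressureFlux_eq_zero hm hx]
  have i3 : Integrable fun x => M * density m V x * Q x * φ x :=
    integrable_of_eq_zero (δ := δ) (by fun_prop) fun x hx => by
      simp [h.density_eq_zero hm hx]
  set f : ℝ → ℝ := fun x => (φ x * A x * P x + A x * φ' x * Q x) + M * density m V x * Q x * φ x
    with hf
  have hfi : Integrable f := (i1.add i2).add i3
  suffices hmain : ∫ x, f x ≤ 0 by
    have i12 : Integrable fun x => φ x * A x * P x + A x * φ' x * Q x := i1.add i2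
    rw [show ∫ x, f x = _ from integral_add i12 i3] at hmain
    rw [integral_neg]
    linarith
  -- the kinks of the two truncations
  set E := ({x | density m V x = a} ∪ {x | density m V x = b}) ∪
    ({x | density m V x = a'} ∪ {x | density m V x = b'}) with hE
  have hEc : E.Countable := (h.countable_kinks hm ha (ha.trans hab)).union
    (h.countable_kinks hm ha' (ha'.trans hab'))
  have hQd : ∀ x ∉ E, HasDerivAt Q (P x) x := by
    intro x hx
    refine (((h.hasDerivAt_trunc_density_off_kinks hm ha hab x
      fun hx' => hx (Or.inl hx')).sub_const l).mul
      ((h.hasDerivAt_trunc_density_off_kinks hm ha' hab' x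
      fun hx' => hx (Or.inr hx')).sub_const l')).congr_deriv ?_
    rw [hP, truncProdGrad]
    ring
  have hβ : ∀ β ∈ Ioo 0 δ, ∫ x in (-β)..β, f x ≤ A β * φ β * Q β - A (-β) * φ (-β) * Q (-β) := by
    intro β hβ
    have hsub : Icc (-β) β ⊆ Ioo (-δ) δ := fun x hx =>
      ⟨by linarith [hx.1, hβ.2], by linarith [hx.2, hβ.2]⟩
    have hle : -β ≤ β := by linarith [hβ.1]
    have j0 : IntervalIntegrable (fun x => A' x * φ x * Q x) volume (-β) β := by
      refine ContinuousOn.intervalIntegrable ?_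
      rw [uIcc_of_le hle]
      exact ((hA'c.mono hsub).mul hφc.continuousOn).mul hQc.continuousOn
    have j1 : IntervalIntegrable (fun x => φ x * A x * P x + A x * φ' x * Q x) volume (-β) β :=
      (i1.add i2).intervalIntegrable
    have hparts := integral_eq_of_hasDerivAt_off_countable (a := -β) (b := β)
      (fun x => A x * φ x * Q x)
      (fun x => A' x * φ x * Q x + (φ x * A x * P x + A x * φ' x * Q x)) hEc
      ((hAc.mul hφc).mul hQc).continuousOn
      (by
        intro x hx
        rw [min_eq_left hle, max_eq_right hle] at hx
        refine (((hA'd x (hsub (Ioo_subset_Icc_self hx.1))).mul (hφ x)).mul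
          (hQd x hx.2)).congr_deriv ?_
        simp only [Pi.mul_apply]
        ring)
      (j0.add j1)
    rw [← hparts]
    refine intervalIntegral.integral_mono_on hle hfi.intervalIntegrable (j0.add j1) fun x hx => ?_
    have h1 : M * density m V x * (Q x * φ x) ≤ A' x * (Q x * φ x) :=
      mul_le_mul_of_nonpos_right (hA'le x (hsub hx))
        (mul_nonpos_of_nonpos_of_nonneg (hQ0 x) (hφ0 x))
    simp only [hf]
    linarith
  have hFc : Continuous fun y => ∫ x in (0 : ℝ)..y, f x :=
    intervalIntegral.continuous_primitive (fun _ _ => hfi.intervalIntegrable) 0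
  have hδ := h.delta_pos
  have hlim1 : Tendsto (fun β => ∫ x in (-β)..β, f x) (𝓝[<] δ) (𝓝 (∫ x in (-δ)..δ, f x)) := by
    have hcont : Continuous fun β => ∫ x in (-β)..β, f x := by
      have : (fun β => ∫ x in (-β)..β, f x) =
          fun β => (∫ x in (0 : ℝ)..β, f x) - ∫ x in (0 : ℝ)..(-β), f x := by
        ext β
        exact (intervalIntegral.integral_interval_sub_left hfi.intervalIntegrable
          hfi.intervalIntegrable).symm
      rw [this]
      exact hFc.sub (hFc.comp continuous_neg)
    exact (hcont.tendsto δ).mono_left nhdsWithin_le_nhds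
  have hlim2 : Tendsto (fun β => A β * φ β * Q β - A (-β) * φ (-β) * Q (-β)) (𝓝[<] δ) (𝓝 0) := by
    have hcont : Continuous fun β => A β * φ β * Q β - A (-β) * φ (-β) * Q (-β) := by fun_prop
    have h1 : A δ = 0 := h.pressureFlux_eq_zero hm (by simp)
    have h2 : A (-δ) = 0 := h.pressureFlux_eq_zero hm (by simp)
    have := (hcont.tendsto δ).mono_left (nhdsWithin_le_nhds (s := Iio δ))
    simpa [h1, h2] using this
  have hfinal : ∫ x in (-δ)..δ, f x ≤ 0 := by
    refine le_of_tendsto_of_tendsto hlim1 hlim2 ?_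
    filter_upwards [Ioo_mem_nhdsLT hδ] with β hb using hβ β hb
  rwa [intervalIntegral.integral_of_le (by linarith),
    setIntegral_eq_integral_of_forall_compl_eq_zero] at hfinal
  intro x hx
  have hx' : x ∉ Ioo (-δ) δ := fun hc => hx (Ioo_subset_Ioc_self hc)
  simp [hf, hA, h.pressureFlux_eq_zero hm hx', h.density_eq_zero hm hx']

end IsBump

/-! ### Separated profiles in space-time -/

/-- Only the values of `u` at times in `[0, T]` matter. -/
theorem IsEntropySuperSolution.congr {m ν c T : ℝ} {u u' : ℝ → ℝ → ℝ}
    (h : IsEntropySuperSolution m ν c T u) (he : ∀ t ∈ Icc 0 T, u t = u' t) :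
    IsEntropySuperSolution m ν c T u' := by
  have heo : ∀ t ∈ Ioo 0 T, u t = u' t := fun t ht => he t (Ioo_subset_Icc_self ht)
  have hae : ∀ᵐ t ∂(volume.restrict (Ioo 0 T)), u t = u' t :=
    (ae_restrict_mem measurableSet_Ioo).mono heo
  refine ⟨?_, ?_, ?_, ?_, ?_, ?_, ?_⟩
  · refine h.measurable.congr ?_
    filter_upwards [ae_restrict_mem (measurableSet_Ioo.prod MeasurableSet.univ)] with q hq
    rw [heo _ hq.1]
  · intro t ht x
    rw [← heo t ht]
    exact h.nonneg t ht x
  · intro t ht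
    rw [← he t ht]
    exact h.integrable t ht
  · intro t₀ ht₀
    refine (h.continuous_L1 t₀ ht₀).congr' ?_
    filter_upwards [self_mem_nhdsWithin] with t ht
    rw [he t ht, he t₀ ht₀]
  · intro a b ha hab
    obtain ⟨h1, h2, h3⟩ := h.trunc_bv a b ha hab
    refine ⟨?_, fun ψ hψ => (h2 ψ hψ).congr ?_, fun R t₁ t₂ hR ht₁ ht ht₂ => ?_⟩
    · filter_upwards [h1, hae] with t ht ht'
      rwa [ht'] at ht
    · filter_upwards [hae] with t ht
      rw [ht]
    · refine lt_of_eq_of_lt (setLIntegral_congr_fun measurableSet_Ioo fun t htt => ?_)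
        (h3 R t₁ t₂ hR ht₁ ht ht₂)
      simp only [heo t ⟨ht₁.trans htt.1, htt.2.trans ht₂⟩]
  · filter_upwards [h.flux_bounded, hae] with t ht ht'
    rwa [ht'] at ht
  · intro φ hφ hφc hφs hφ0 a b l ha hab hl a' b' l' ha' hab' hl'
    obtain ⟨h1, h2, h3⟩ := h.entropy φ hφ hφc hφs hφ0 a b l ha hab hl a' b' l' ha' hab' hl'
    have e1 : EqOn
        (fun t => entropyLHS m ν c a b l a' b' l' (u t) (fun x => φ (t, x)))
        (fun t => entropyLHS m ν c a b l a' b' l' (u' t) (fun x => φ (t, x))) (Ioo 0 T) :=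
      fun t ht => by simp only [heo t ht]
    have e2 : EqOn
        (fun t => entropyRHS m ν c a b l a' b' l' (u t)
          (fun x => deriv (fun s => φ (s, x)) t) (fun x => deriv (fun y => φ (t, y)) x))
        (fun t => entropyRHS m ν c a b l a' b' l' (u' t)
          (fun x => deriv (fun s => φ (s, x)) t) (fun x => deriv (fun y => φ (t, y)) x))
        (Ioo 0 T) :=
      fun t ht => by simp only [heo t ht]
    refine ⟨h1.congr_fun e1 measurableSet_Ioo, h2.congr_fun e2 measurableSet_Ioo, ?_⟩
    rwa [setIntegral_congr_fun measurableSet_Ioo e1, setIntegral_congr_fun measurableSet_Ioo e2]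
      at h3

theorem hasDerivAt_fst {φ : ℝ × ℝ → ℝ} (hφ : ContDiff ℝ ∞ φ) (t x : ℝ) :
    HasDerivAt (fun s => φ (s, x)) (fderiv ℝ φ (t, x) (1, 0)) t :=
  ((hφ.differentiable (by simp)) (t, x)).hasFDerivAt.comp_hasDerivAt t
    ((hasDerivAt_id t).prodMk (hasDerivAt_const t x))

theorem hasDerivAt_snd {φ : ℝ × ℝ → ℝ} (hφ : ContDiff ℝ ∞ φ) (t x : ℝ) :
    HasDerivAt (fun y => φ (t, y)) (fderiv ℝ φ (t, x) (0, 1)) x :=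
  ((hφ.differentiable (by simp)) (t, x)).hasFDerivAt.comp_hasDerivAt x
    ((hasDerivAt_const x t).prodMk (hasDerivAt_id x))

theorem continuous_fderiv_apply {φ : ℝ × ℝ → ℝ} (hφ : ContDiff ℝ ∞ φ) (e : ℝ × ℝ) :
    Continuous fun p => fderiv ℝ φ p e :=
  (hφ.continuous_fderiv (by simp)).clm_apply continuous_const

theorem hasCompactSupport_fderiv_apply {φ : ℝ × ℝ → ℝ} (hφ : HasCompactSupport φ) (e : ℝ × ℝ) :
    HasCompactSupport fun p => fderiv ℝ φ p e :=
  (hφ.fderiv ℝ).comp_left (g := fun L : ℝ × ℝ →L[ℝ] ℝ => L e) rfl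

namespace IsBump

variable {δ K m ν c S : ℝ} {V D D' s : ℝ → ℝ}

theorem continuous_density_uncurry (h : IsBump δ K V D D') (hm : 1 ≤ m) (hs : Continuous s) :
    Continuous fun p : ℝ × ℝ => density m (fun x => s p.1 * V x) p.2 := by
  have hV := h.continuous
  refine Continuous.rpow_const (by fun_prop) fun _ => Or.inr (by positivity)

theorem continuous_pressureFlux_uncurry (h : IsBump δ K V D D') (hm : 1 ≤ m) (hs : Continuous s) :
    Continuous fun p : ℝ × ℝ =>
      pressureFlux m ν c (fun x => s p.1 * V x) (fun x => s p.1 * D x) p.2 := by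
  have hD := h.continuous_deriv
  exact ((h.continuous_density_uncurry hm hs).const_mul ν).mul
    ((continuous_limiter (by positivity)).comp (by fun_prop))

theorem measurable_truncDensityGrad_uncurry (h : IsBump δ K V D D') (hm : 1 ≤ m)
    (hs : Continuous s) (a b : ℝ) :
    Measurable fun p : ℝ × ℝ =>
      truncDensityGrad m a b (fun x => s p.1 * V x) (fun x => s p.1 * D x) p.2 := by
  have hu := (h.continuous_density_uncurry hm hs).measurable
  have hD : Measurable fun p : ℝ × ℝ => s p.1 * D p.2 := by
    have := h.continuous_deriv
    exact Continuous.measurable (by fun_prop)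
  have hg : Measurable fun p : ℝ × ℝ =>
      densityGrad m (fun x => s p.1 * V x) (fun x => s p.1 * D x) p.2 :=
    (measurable_const.mul (hu.pow_const _)).mul hD
  exact hg.indicator (s := {p : ℝ × ℝ | a < density m (fun x => s p.1 * V x) p.2 ∧
    density m (fun x => s p.1 * V x) p.2 < b})
    ((measurableSet_lt measurable_const hu).inter (measurableSet_lt hu measurable_const))

theorem measurable_truncProdGrad_uncurry (h : IsBump δ K V D D') (hm : 1 ≤ m)
    (hs : Continuous s) (a b l a' b' l' : ℝ) :
    Measurable fun p : ℝ × ℝ =>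
      truncProdGrad m a b l a' b' l' (fun x => s p.1 * V x) (fun x => s p.1 * D x) p.2 := by
  have hu := h.continuous_density_uncurry hm hs
  have ht : ∀ a b : ℝ, Measurable fun p : ℝ × ℝ =>
      trunc a b (density m (fun x => s p.1 * V x) p.2) := fun a b =>
    ((continuous_trunc a b).comp hu).measurable
  exact (((ht a' b').sub_const l').mul (h.measurable_truncDensityGrad_uncurry hm hs a b)).add
    (((ht a b).sub_const l).mul (h.measurable_truncDensityGrad_uncurry hm hs a' b'))

theorem exists_truncDensityGrad_bound (h : IsBump δ K V D D') (hm : 1 ≤ m)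
    (hpos : ∀ t, 0 < s t) (hS : ∀ t, s t ≤ S) {a b : ℝ} (ha : 0 < a) :
    ∃ C, 0 ≤ C ∧ ∀ t x,
      |truncDensityGrad m a b (fun x => s t * V x) (fun x => s t * D x) x| ≤ C := by
  obtain ⟨C, hC0, hC⟩ := h.exists_deriv_bound
  have ha' := Real.rpow_nonneg ha.le (1 - m)
  have hS0 : 0 ≤ S := (hpos 0).le.trans (hS 0)
  refine ⟨1 / m * a ^ (1 - m) * (S * C), by positivity, fun t x => ?_⟩
  refine ((h.smul (hpos t)).abs_truncDensityGrad_le hm ha x).trans ?_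
  refine mul_le_mul_of_nonneg_left ?_ (by positivity)
  rw [abs_mul, abs_of_pos (hpos t)]
  exact mul_le_mul (hS t) (hC x) (abs_nonneg _) hS0

theorem exists_truncProdGrad_bound (h : IsBump δ K V D D') (hm : 1 ≤ m)
    (hpos : ∀ t, 0 < s t) (hS : ∀ t, s t ≤ S) {a b l a' b' l' : ℝ} (ha : 0 < a) (hab : a < b)
    (ha' : 0 < a') (hab' : a' < b') :
    ∃ C, ∀ t x,
      |truncProdGrad m a b l a' b' l' (fun x => s t * V x) (fun x => s t * D x) x| ≤ C := by
  obtain ⟨C₁, h0₁, h₁⟩ := h.exists_truncDensityGrad_bound hm hpos hS (b := b) ha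
  obtain ⟨C₂, h0₂, h₂⟩ := h.exists_truncDensityGrad_bound hm hpos hS (b := b') ha'
  refine ⟨(b' + |l'|) * C₁ + (b + |l|) * C₂, fun t x => ?_⟩
  refine (abs_add_le _ _).trans ?_
  rw [abs_mul, abs_mul]
  have hb : ∀ {a b : ℝ} (l r : ℝ), 0 < a → a < b → |trunc a b r - l| ≤ b + |l| :=
    fun l r ha hab => (abs_sub _ _).trans (add_le_add_left (abs_trunc_le ha hab r) _)
  exact add_le_add
    (mul_le_mul (hb l' _ ha' hab') (h₁ t x) (abs_nonneg _)
      ((abs_nonneg _).trans (hb l' 0 ha' hab')))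
    (mul_le_mul (hb l _ ha hab) (h₂ t x) (abs_nonneg _)
      ((abs_nonneg _).trans (hb l 0 ha hab)))

theorem memL1LocBVLoc (h : IsBump δ K V D D') (hm : 1 ≤ m) (hs : Continuous s)
    (hpos : ∀ t, 0 < s t) (hS : ∀ t, s t ≤ S) {a b : ℝ} (ha : 0 < a) (hab : a < b) (T : ℝ) :
    MemL1LocBVLoc T fun t x => trunc a b (density m (fun x => s t * V x) x) - a := by
  have hbv : ∀ t, IsBVDeriv (fun x => trunc a b (density m (fun x => s t * V x) x) - a) _ _ :=
    fun t => isBVDeriv_of_hasDerivAt ((h.smul (hpos t)).countable_kinks hm ha (ha.trans hab))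
      (((h.smul (hpos t)).continuous_trunc_density hm a b).sub continuous_const)
      (fun x hx => ((h.smul (hpos t)).hasDerivAt_trunc_density_off_kinks hm ha hab x hx).sub_const a)
      ((h.smul (hpos t)).measurable_truncDensityGrad hm a b)
      ((h.smul (hpos t)).integrable_truncDensityGrad hm ha)
  have hwc : Continuous fun p : ℝ × ℝ =>
      trunc a b (density m (fun x => s p.1 * V x) p.2) - a :=
    ((continuous_trunc a b).comp (h.continuous_density_uncurry hm hs)).sub continuous_const
  refine ⟨Eventually.of_forall fun t => ⟨(_, _), hbv t⟩, fun ψ hψ => ?_, ?_⟩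
  · refine Measurable.aemeasurable (StronglyMeasurable.measurable ?_)
    exact StronglyMeasurable.integral_prod_right (f := fun t x : ℝ =>
      (trunc a b (density m (fun x => s t * V x) x) - a) * ψ x)
      (hwc.mul (hψ.1.continuous.comp continuous_snd)).stronglyMeasurable
  · intro R t₁ t₂ hR _ _ _
    obtain ⟨C, hC0, hC⟩ := h.exists_truncDensityGrad_bound hm hpos hS (b := b) ha
    set L := volume (Ioo (-R) R) with hL
    have hLtop : L < ⊤ := measure_Ioo_lt_top
    refine lt_of_le_of_lt (lintegral_mono (g := fun _ =>
      ENNReal.ofReal (b + a) * L + (ENNReal.ofReal C * L + ENNReal.ofReal C * L)) fun t => ?_) ?_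
    · obtain ⟨hp, hn⟩ := (hbv t).bvPair_eq
      refine add_le_add ?_ ?_
      · refine (lintegral_mono (g := fun _ => ENNReal.ofReal (b + a)) fun x => ?_).trans
          (setLIntegral_const _ _).le
        rw [Real.enorm_eq_ofReal_abs]
        refine ENNReal.ofReal_le_ofReal ((abs_sub _ _).trans ?_)
        rw [abs_of_pos ha]
        exact add_le_add_left (abs_trunc_le ha hab _) _
      · rw [hp, hn, Measure.add_apply, withDensity_apply _ measurableSet_Ioo,
          withDensity_apply _ measurableSet_Ioo]
        refine add_le_add ?_ ?_
        · refine (lintegral_mono (g := fun _ => ENNReal.ofReal C) fun x => ?_).trans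
            (setLIntegral_const _ _).le
          exact ENNReal.ofReal_le_ofReal ((le_abs_self _).trans (hC t x))
        · refine (lintegral_mono (g := fun _ => ENNReal.ofReal C) fun x => ?_).trans
            (setLIntegral_const _ _).le
          exact ENNReal.ofReal_le_ofReal ((neg_le_abs _).trans (hC t x))
    · rw [setLIntegral_const]
      refine ENNReal.mul_lt_top ?_ measure_Ioo_lt_top
      have h1 := ENNReal.mul_lt_top (ENNReal.ofReal_lt_top (r := C)) hLtop
      exact ENNReal.add_lt_top.2 ⟨ENNReal.mul_lt_top ENNReal.ofReal_lt_top hLtop,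
        ENNReal.add_lt_top.2 ⟨h1, h1⟩⟩

theorem tendsto_integral_abs_sub (h : IsBump δ K V D D') (hm : 1 ≤ m) (hs : Continuous s)
    (hpos : ∀ t, 0 < s t) (t₀ : ℝ) :
    Tendsto (fun t => ∫ x, |density m (fun x => s t * V x) x - density m (fun x => s t₀ * V x) x|)
      (𝓝 t₀) (𝓝 0) := by
  have hu := h.continuous_density_uncurry hm hs
  have hu₀ := (h.smul (hpos t₀)).continuous_density hm
  have hc := continuous_parametric_integral_of_continuous (μ := volume)
    (f := fun t x => |density m (fun x => s t * V x) x - density m (fun x => s t₀ * V x) x|)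
    (show Continuous fun p : ℝ × ℝ => _ from (hu.sub (hu₀.comp continuous_snd)).abs)
    (isCompact_Icc (a := -δ) (b := δ))
  have e : ∀ t, ∫ x in Icc (-δ) δ,
      |density m (fun x => s t * V x) x - density m (fun x => s t₀ * V x) x| =
      ∫ x, |density m (fun x => s t * V x) x - density m (fun x => s t₀ * V x) x| := fun t =>
    setIntegral_eq_integral_of_forall_compl_eq_zero fun x hx => by
      have hx' : x ∉ Ioo (-δ) δ := fun hc => hx (Ioo_subset_Icc_self hc)
      rw [(h.smul (hpos t)).density_eq_zero hm hx', (h.smul (hpos t₀)).density_eq_zero hm hx',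
        sub_zero, abs_zero]
  simp only [e] at hc
  simpa using hc.tendsto t₀

theorem hasDerivAt_density_time (h : IsBump δ K V D D') (hm : 1 ≤ m) (hpos : ∀ t, 0 < s t) {t : ℝ}
    (hsd : HasDerivAt s ((2 + m) * ν * K * s t ^ 2) t) (x : ℝ) :
    HasDerivAt (fun t => density m (fun x => s t * V x) x)
      (ν * (s t * K) * (2 + m) / m * density m (fun x => s t * V x) x) t := by
  by_cases hx : x ∈ Ioo (-δ) δ
  · have hsV := (h.smul (hpos t)).pos x hx
    refine ((hsd.mul_const (V x)).rpow_const (p := 1 / m) (Or.inl hsV.ne')).congr_deriv ?_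
    rw [Real.rpow_sub_one hsV.ne', density]
    have hV := (h.pos x hx).ne'
    have hst := (hpos t).ne'
    have hm0 : m ≠ 0 := by positivity
    field_simp
  · have e : ∀ t, density m (fun x => s t * V x) x = 0 := fun t =>
      (h.smul (hpos t)).density_eq_zero hm hx
    simp only [e, mul_zero]
    exact hasDerivAt_const t 0

end IsBump

/-! ### The entropy inequality in space-time -/

theorem integrable_prod_restrict {F : ℝ × ℝ → ℝ} (hF : Integrable F) (I : Set ℝ) :
    Integrable F ((volume.restrict I).prod volume) := by
  have : (volume.restrict I).prod (volume : Measure ℝ) =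
      (volume : Measure (ℝ × ℝ)).restrict (I ×ˢ univ) := by
    rw [Measure.volume_eq_prod, ← Measure.prod_restrict, Measure.restrict_univ]
  rw [this]
  exact hF.restrict

namespace IsBump

variable {δ K m ν c S T : ℝ} {V D D' s : ℝ → ℝ}

/-- The time derivative of `J_{TS}(u)` is `T(u) S(u) u_t`; as the test function vanishes at the times
`0` and `T`, it can be moved off the test function. -/
theorem integral_time_eq (h : IsBump δ K V D D') (hm : 1 ≤ m) (hs : Continuous s)
    (hpos : ∀ t, 0 < s t) (hT : 0 < T)
    (hsd : ∀ t ∈ Ioo 0 T, HasDerivAt s ((2 + m) * ν * K * s t ^ 2) t)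
    {q : ℝ → ℝ} (hq : Continuous q) {φ φ' : ℝ → ℝ} (hφ : ∀ t, HasDerivAt φ (φ' t) t)
    (hφ' : Continuous φ') (hφ0 : φ 0 = 0) (hφT : φ T = 0) (x : ℝ) :
    ∫ t in Ioo 0 T, (∫ r in (0 : ℝ)..(density m (fun x => s t * V x) x), q r) * φ' t =
      ∫ t in Ioo 0 T, -(ν * (s t * K) * (2 + m) / m * density m (fun x => s t * V x) x
        * q (density m (fun x => s t * V x) x) * φ t) := by
  have hφc : Continuous φ := continuous_iff_continuousAt.2 fun x => (hφ x).continuousAt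
  have hu : Continuous fun t => density m (fun x => s t * V x) x :=
    (h.continuous_density_uncurry hm hs).comp (by fun_prop : Continuous fun t : ℝ => (t, x))
  set u : ℝ → ℝ := fun t => density m (fun x => s t * V x) x with hu_def
  have hJ : ∀ r, HasDerivAt (fun r => ∫ z in (0 : ℝ)..r, q z) (q r) r := fun r =>
    intervalIntegral.integral_hasDerivAt_right (hq.intervalIntegrable _ _)
      (hq.stronglyMeasurableAtFilter _ _) hq.continuousAt
  have hJc : Continuous fun r => ∫ z in (0 : ℝ)..r, q z :=
    continuous_iff_continuousAt.2 fun r => (hJ r).continuousAt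
  have c1 : Continuous fun t => (∫ r in (0 : ℝ)..(u t), q r) * φ' t := (hJc.comp hu).mul hφ'
  have c2 : Continuous fun t => ν * (s t * K) * (2 + m) / m * u t * q (u t) * φ t := by fun_prop
  have hftc := intervalIntegral.integral_eq_sub_of_hasDerivAt_of_le hT.le
    (f := fun t => (∫ r in (0 : ℝ)..(u t), q r) * φ t)
    (f' := fun t => ν * (s t * K) * (2 + m) / m * u t * q (u t) * φ t
      + (∫ r in (0 : ℝ)..(u t), q r) * φ' t)
    ((hJc.comp hu).mul hφc).continuousOn
    (fun t ht => by
      refine (((hJ (u t)).comp t (h.hasDerivAt_density_time hm hpos (hsd t ht) x)).mul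
        (hφ t)).congr_deriv ?_
      simp only [Function.comp_apply, hu_def]
      ring)
    ((c2.add c1).intervalIntegrable _ _)
  rw [intervalIntegral.integral_add (c2.intervalIntegrable _ _) (c1.intervalIntegrable _ _),
    hφ0, hφT, intervalIntegral.integral_of_le hT.le, intervalIntegral.integral_of_le hT.le,
    integral_Ioc_eq_integral_Ioo, integral_Ioc_eq_integral_Ioo] at hftc
  rw [integral_neg]
  linarith

/-- The amplitude `s` solves `s' = (2 + m) ν K s²`, so that `u_t` equals the upper bound for
`a(u, u_x)_x` given by `exists_hasDerivAt_pressureFlux` for the pressure `s V`. -/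
theorem entropy_spacetime (h : IsBump δ K V D D') (hm : 1 ≤ m) (hν : 0 < ν) (hs : Continuous s)
    (hpos : ∀ t, 0 < s t) (hS : ∀ t, s t ≤ S)
    (hsd : ∀ t ∈ Ioo 0 T, HasDerivAt s ((2 + m) * ν * K * s t ^ 2) t) (hT : 0 < T)
    {φ : ℝ × ℝ → ℝ} (hφ : ContDiff ℝ ∞ φ) (hφc : HasCompactSupport φ)
    (hφs : tsupport φ ⊆ Ioo 0 T ×ˢ univ) (hφ0 : ∀ q, 0 ≤ φ q)
    {a b l : ℝ} (ha : 0 < a) (hab : a < b) (hl : ∀ r, 0 ≤ trunc a b r - l)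
    {a' b' l' : ℝ} (ha' : 0 < a') (hab' : a' < b') (hl' : ∀ r, trunc a' b' r - l' ≤ 0) :
    IntegrableOn (fun t => entropyLHS m ν c a b l a' b' l' (density m fun x => s t * V x)
      (fun x => φ (t, x))) (Ioo 0 T) ∧
    IntegrableOn (fun t => entropyRHS m ν c a b l a' b' l' (density m fun x => s t * V x)
      (fun x => deriv (fun s => φ (s, x)) t) (fun x => deriv (fun y => φ (t, y)) x)) (Ioo 0 T) ∧
    ∫ t in Ioo 0 T, entropyLHS m ν c a b l a' b' l' (density m fun x => s t * V x)
      (fun x => φ (t, x)) ≤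
    ∫ t in Ioo 0 T, entropyRHS m ν c a b l a' b' l' (density m fun x => s t * V x)
      (fun x => deriv (fun s => φ (s, x)) t) (fun x => deriv (fun y => φ (t, y)) x) := by
  set U : ℝ → ℝ → ℝ := fun t => density m fun x => s t * V x with hU
  set A : ℝ → ℝ → ℝ := fun t => pressureFlux m ν c (fun x => s t * V x) (fun x => s t * D x)
    with hA
  set P : ℝ → ℝ → ℝ := fun t => truncProdGrad m a b l a' b' l' (fun x => s t * V x)
    (fun x => s t * D x) with hP
  set q := truncProd a b l a' b' l' with hq
  set φt : ℝ × ℝ → ℝ := fun p => fderiv ℝ φ p (1, 0) with hφt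
  set φx : ℝ × ℝ → ℝ := fun p => fderiv ℝ φ p (0, 1) with hφx
  have hφcont := hφ.continuous
  have hφtc : Continuous φt := continuous_fderiv_apply hφ _
  have hφxc : Continuous φx := continuous_fderiv_apply hφ _
  have hqc : Continuous q := continuous_truncProd a b l a' b' l'
  have hJc : Continuous fun r => ∫ z in (0 : ℝ)..r, q z :=
    intervalIntegral.continuous_primitive (fun _ _ => hqc.intervalIntegrable _ _) 0
  have hUc : Continuous fun p : ℝ × ℝ => U p.1 p.2 := h.continuous_density_uncurry hm hs
  have hAc : Continuous fun p : ℝ × ℝ => A p.1 p.2 := h.continuous_pressureFlux_uncurry hm hs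
  have hPm : Measurable fun p : ℝ × ℝ => P p.1 p.2 :=
    h.measurable_truncProdGrad_uncurry hm hs a b l a' b' l'
  obtain ⟨C, hC⟩ : ∃ C, ∀ t x, |P t x| ≤ C :=
    h.exists_truncProdGrad_bound hm hpos hS ha hab ha' hab'
  -- `P` is only bounded and measurable; every other factor is continuous, and `φ` or one of its
  -- derivatives gives compact support
  have i1 : Integrable fun p : ℝ × ℝ => φ p * A p.1 p.2 * P p.1 p.2 :=
    ((hφcont.mul hAc).integrable_of_hasCompactSupport hφc.mul_right).mul_bdd
      hPm.aestronglyMeasurable (Eventually.of_forall fun p => hC p.1 p.2)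
  have i2 : Integrable fun p : ℝ × ℝ => A p.1 p.2 * φx p * q (U p.1 p.2) :=
    ((hAc.mul hφxc).mul (hqc.comp hUc)).integrable_of_hasCompactSupport
      (hasCompactSupport_fderiv_apply hφc _).mul_left.mul_right
  have i3 : Integrable fun p : ℝ × ℝ => (∫ r in (0 : ℝ)..(U p.1 p.2), q r) * φt p :=
    ((hJc.comp hUc).mul hφtc).integrable_of_hasCompactSupport
      (hasCompactSupport_fderiv_apply hφc _).mul_left
  have i4 : Integrable fun p : ℝ × ℝ =>
      -(ν * (s p.1 * K) * (2 + m) / m * U p.1 p.2 * q (U p.1 p.2) * φ p) := by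
    have hc : Continuous fun p : ℝ × ℝ =>
        ν * (s p.1 * K) * (2 + m) / m * U p.1 p.2 * q (U p.1 p.2) * φ p := by fun_prop
    exact (hc.integrable_of_hasCompactSupport hφc.mul_left).neg
  have j1 := integrable_prod_restrict i1 (Ioo 0 T)
  have j2 := integrable_prod_restrict i2 (Ioo 0 T)
  have j3 := integrable_prod_restrict i3 (Ioo 0 T)
  have j4 := integrable_prod_restrict i4 (Ioo 0 T)
  have eL : ∀ t, entropyLHS m ν c a b l a' b' l' (density m fun x => s t * V x) (fun x => φ (t, x)) =
      ∫ x, φ (t, x) * A t x * P t x := fun t =>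
    (h.smul (hpos t)).entropyLHS_eq hm ha hab ha' hab' (by fun_prop)
  have eR : ∀ t, entropyRHS m ν c a b l a' b' l' (density m fun x => s t * V x)
      (fun x => deriv (fun s => φ (s, x)) t) (fun x => deriv (fun y => φ (t, y)) x) =
      ∫ x, ((∫ r in (0 : ℝ)..(U t x), q r) * φt (t, x) - A t x * φx (t, x) * q (U t x)) := by
    intro t
    simp only [(hasDerivAt_fst hφ t _).deriv, (hasDerivAt_snd hφ t _).deriv]
    exact (h.smul (hpos t)).entropyRHS_eq hm a b l a' b' l' _ _
  simp only [eL, eR]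
  refine ⟨j1.integral_prod_left, (j3.sub j2).integral_prod_left, ?_⟩
  have hspace : ∀ t ∈ Ioo 0 T, ∫ x, (φ (t, x) * A t x * P t x + A t x * φx (t, x) * q (U t x)) ≤
      ∫ x, -(ν * (s t * K) * (2 + m) / m * U t x * q (U t x) * φ (t, x)) := fun t _ =>
    (h.smul (hpos t)).entropy_inequality hm hν ha hab hl ha' hab' hl'
      (fun x => hasDerivAt_snd hφ t x)
      (hφxc.comp (by fun_prop : Continuous fun x : ℝ => (t, x))) fun x => hφ0 _
  have hedge : ∀ t, t ∉ Ioo 0 T → ∀ x, φ (t, x) = 0 := fun t ht x =>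
    image_eq_zero_of_notMem_tsupport fun hx => ht (hφs hx).1
  have htime : ∀ x, ∫ t in Ioo 0 T, (∫ r in (0 : ℝ)..(U t x), q r) * φt (t, x) =
      ∫ t in Ioo 0 T, -(ν * (s t * K) * (2 + m) / m * U t x * q (U t x) * φ (t, x)) := fun x =>
    h.integral_time_eq hm hs hpos hT hsd hqc (fun t => hasDerivAt_fst hφ t x)
      (hφtc.comp (by fun_prop : Continuous fun t : ℝ => (t, x)))
      (hedge 0 (by simp) x) (hedge T (by simp) x) x
  have hI34 : ∫ t in Ioo 0 T, ∫ x, (∫ r in (0 : ℝ)..(U t x), q r) * φt (t, x) =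
      ∫ t in Ioo 0 T, ∫ x, -(ν * (s t * K) * (2 + m) / m * U t x * q (U t x) * φ (t, x)) := by
    refine (integral_integral_swap j3).trans (Eq.trans ?_ (integral_integral_swap j4).symm)
    simp only [htime]
  have hI12 : ∫ t in Ioo 0 T, ∫ x,
        (φ (t, x) * A t x * P t x + A t x * φx (t, x) * q (U t x)) ≤
      ∫ t in Ioo 0 T, ∫ x, -(ν * (s t * K) * (2 + m) / m * U t x * q (U t x) * φ (t, x)) :=
    setIntegral_mono_on (j1.add j2).integral_prod_left j4.integral_prod_left measurableSet_Ioo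
      hspace
  have e12 := integral_integral_add j1 j2
  have e32 := integral_integral_sub j3 j2
  rw [e12] at hI12
  rw [e32]
  linarith

theorem isEntropySuperSolution (h : IsBump δ K V D D') (hm : 1 ≤ m) (hν : 0 < ν)
    (hs : Continuous s) (hpos : ∀ t, 0 < s t) (hS : ∀ t, s t ≤ S)
    (hsd : ∀ t ∈ Ioo 0 T, HasDerivAt s ((2 + m) * ν * K * s t ^ 2) t) (hT : 0 < T) :
    IsEntropySuperSolution m ν c T fun t => density m fun x => s t * V x where
  measurable := (h.continuous_density_uncurry hm hs).aemeasurable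
  nonneg t _ x := (h.smul (hpos t)).density_nonneg x
  integrable t _ := integrable_of_eq_zero ((h.smul (hpos t)).continuous_density hm)
    fun x hx => (h.smul (hpos t)).density_eq_zero hm hx
  continuous_L1 t₀ _ := (h.tendsto_integral_abs_sub hm hs hpos t₀).mono_left nhdsWithin_le_nhds
  trunc_bv a b ha hab := h.memL1LocBVLoc hm hs hpos hS ha hab T
  flux_bounded := by
    refine Eventually.of_forall fun t R => ?_
    have hb := h.smul (hpos t)
    obtain ⟨C, hC⟩ := (HasCompactSupport.intro (isCompact_Icc (a := -δ) (b := δ)) fun x hx =>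
      hb.pressureFlux_eq_zero (ν := ν) (c := c) hm
        fun hx' => hx (Ioo_subset_Icc_self hx')).exists_bound_of_continuous
          (hb.continuous_pressureFlux hm)
    refine ⟨C, ae_restrict_of_ae ?_⟩
    filter_upwards [hb.flux_truncGrad_ae_eq (ν := ν) (c := c) hm] with x hx
    rw [hx]
    exact hC x
  entropy _ hφ hφc hφs hφ0 _ _ _ ha hab hl _ _ _ ha' hab' hl' :=
    h.entropy_spacetime hm hν hs hpos hS hsd hT hφ hφc hφs hφ0 ha hab hl ha' hab' hl'

end IsBump

/-! ### Profiles with bounded second derivative -/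

/-- A function on `(-δ, δ)` that tends to zero at both ends, extended by zero, is continuous. -/
theorem continuous_indicator_Ioo {δ : ℝ} {f : ℝ → ℝ} (hf : ContinuousOn f (Ioo (-δ) δ))
    (hr : Tendsto f (𝓝[<] δ) (𝓝 0)) (hl : Tendsto f (𝓝[>] (-δ)) (𝓝 0)) :
    Continuous ((Ioo (-δ) δ).indicator f) := by
  refine continuous_iff_continuousAt.2 fun x => ?_
  have hout : ∀ {y}, y ∉ Ioo (-δ) δ → (Ioo (-δ) δ).indicator f y = 0 := fun hy =>
    indicator_of_notMem hy f
  have hext : ∀ {L : Filter ℝ}, Tendsto f L (𝓝 0) → Tendsto ((Ioo (-δ) δ).indicator f) L (𝓝 0) := by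
    intro L hL
    refine squeeze_zero_norm (fun y => norm_indicator_le_norm_self f y) ?_
    simpa using hL.norm
  by_cases hx : x ∈ Ioo (-δ) δ
  · refine (hf.continuousAt (isOpen_Ioo.mem_nhds hx)).congr ?_
    filter_upwards [isOpen_Ioo.mem_nhds hx] with y hy
    rw [indicator_of_mem hy]
  · rw [ContinuousAt, hout hx]
    rcases not_and_or.1 hx with hx | hx <;> rw [not_lt] at hx
    · have hle : Tendsto ((Ioo (-δ) δ).indicator f) (𝓝[≤] x) (𝓝 0) := by
        refine tendsto_const_nhds.congr' ?_
        filter_upwards [self_mem_nhdsWithin] with y hy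
        exact (hout fun hy' => (hy'.1.trans_le (le_trans hy hx)).false).symm
      have hgt : Tendsto ((Ioo (-δ) δ).indicator f) (𝓝[>] x) (𝓝 0) := by
        rcases hx.eq_or_lt with rfl | hlt
        · exact hext hl
        · refine tendsto_const_nhds.congr' ?_
          filter_upwards [mem_nhdsWithin_of_mem_nhds (Iio_mem_nhds hlt)] with y hy
          exact (hout fun hy' => (hy'.1.trans hy).false).symm
      rw [← nhdsLE_sup_nhdsGT]
      exact hle.sup hgt
    · have hge : Tendsto ((Ioo (-δ) δ).indicator f) (𝓝[≥] x) (𝓝 0) := by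
        refine tendsto_const_nhds.congr' ?_
        filter_upwards [self_mem_nhdsWithin] with y hy
        exact (hout fun hy' => (hy'.2.trans_le (le_trans hx hy)).false).symm
      have hlt : Tendsto ((Ioo (-δ) δ).indicator f) (𝓝[<] x) (𝓝 0) := by
        rcases hx.eq_or_lt with rfl | hlt
        · exact hext hr
        · refine tendsto_const_nhds.congr' ?_
          filter_upwards [mem_nhdsWithin_of_mem_nhds (Ioi_mem_nhds hlt)] with y hy
          exact (hout fun hy' => (hy'.2.trans hy).false).symm
      rw [← nhdsLT_sup_nhdsGE]
      exact hlt.sup hge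

/-- On `(-δ, 0)` the function `2 k v - v' ^ 2` vanishes at `-δ` and has derivative
`2 v' (k - v'') ≥ 0`; symmetrically on `(0, δ)`. This gives the bound on `v' ^ 2`. -/
theorem isBump_of_profile {δ k : ℝ} {v : ℝ → ℝ} (hδ : 0 < δ)
    (hv_smooth : ContDiffOn ℝ 2 v (Ioo (-δ) δ))
    (hv_right : Tendsto v (𝓝[<] δ) (𝓝 0)) (hv'_right : Tendsto (deriv v) (𝓝[<] δ) (𝓝 0))
    (hv_left : Tendsto v (𝓝[>] (-δ)) (𝓝 0)) (hv'_left : Tendsto (deriv v) (𝓝[>] (-δ)) (𝓝 0))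
    (hv_mono : ∀ x ∈ Ioo (-δ) δ, x ≠ 0 → x * deriv v x < 0)
    (hv'' : ∀ x ∈ Ioo (-δ) δ, deriv (deriv v) x ≤ k) :
    IsBump δ k ((Ioo (-δ) δ).indicator v) ((Ioo (-δ) δ).indicator (deriv v))
      (deriv (deriv v)) := by
  have hv1 : ContDiffOn ℝ 1 (deriv v) (Ioo (-δ) δ) :=
    hv_smooth.deriv_of_isOpen isOpen_Ioo (by norm_num)
  set V := (Ioo (-δ) δ).indicator v with hV
  set D := (Ioo (-δ) δ).indicator (deriv v) with hD
  have hVc : Continuous V := continuous_indicator_Ioo hv_smooth.continuousOn hv_right hv_left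
  have hDc : Continuous D := continuous_indicator_Ioo hv1.continuousOn hv'_right hv'_left
  have hind : ∀ {f f' : ℝ → ℝ} {x : ℝ}, x ∈ Ioo (-δ) δ → HasDerivAt f (f' x) x →
      HasDerivAt ((Ioo (-δ) δ).indicator f) (f' x) x := fun hx hf =>
    hf.congr_of_eventuallyEq (by
      filter_upwards [isOpen_Ioo.mem_nhds hx] with y hy
      exact indicator_of_mem hy _)
  have hVd : ∀ x ∈ Ioo (-δ) δ, HasDerivAt V (D x) x := fun x hx => by
    rw [hD, indicator_of_mem hx]
    exact hind hx (((hv_smooth.differentiableOn (by norm_num)) x hx).differentiableAt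
      (isOpen_Ioo.mem_nhds hx)).hasDerivAt
  have hDd : ∀ x ∈ Ioo (-δ) δ, HasDerivAt D (deriv (deriv v) x) x := fun x hx =>
    hind hx (((hv1.differentiableOn (by norm_num)) x hx).differentiableAt
      (isOpen_Ioo.mem_nhds hx)).hasDerivAt
  have hVl : V (-δ) = 0 := indicator_of_notMem (by simp) _
  have hVr : V δ = 0 := indicator_of_notMem (by simp) _
  have hDl : D (-δ) = 0 := indicator_of_notMem (by simp) _
  have hDr : D δ = 0 := indicator_of_notMem (by simp) _
  have hleft : ∀ x ∈ Ioo (-δ) 0, x ∈ Ioo (-δ) δ ∧ 0 < D x := fun x hx => by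
    have hx' : x ∈ Ioo (-δ) δ := ⟨hx.1, hx.2.trans hδ⟩
    refine ⟨hx', ?_⟩
    rw [hD, indicator_of_mem hx']
    exact pos_of_mul_neg_right (hv_mono x hx' hx.2.ne) hx.2.le
  have hright : ∀ x ∈ Ioo 0 δ, x ∈ Ioo (-δ) δ ∧ D x < 0 := fun x hx => by
    have hx' : x ∈ Ioo (-δ) δ := ⟨by linarith [hx.1], hx.2⟩
    refine ⟨hx', ?_⟩
    rw [hD, indicator_of_mem hx']
    exact neg_of_mul_neg_right (hv_mono x hx' hx.1.ne') hx.1.le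
  have hmono : StrictMonoOn V (Icc (-δ) 0) :=
    strictMonoOn_of_deriv_pos (convex_Icc _ _) hVc.continuousOn fun x hx => by
      rw [interior_Icc] at hx
      rw [(hVd x (hleft x hx).1).deriv]
      exact (hleft x hx).2
  have hanti : StrictAntiOn V (Icc 0 δ) :=
    strictAntiOn_of_deriv_neg (convex_Icc _ _) hVc.continuousOn fun x hx => by
      rw [interior_Icc] at hx
      rw [(hVd x (hright x hx).1).deriv]
      exact (hright x hx).2
  have hfd : ∀ x ∈ Ioo (-δ) δ, HasDerivAt (fun x => 2 * k * V x - D x ^ 2)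
      (2 * D x * (k - deriv (deriv v) x)) x := fun x hx => by
    refine (((hVd x hx).const_mul (2 * k)).sub ((hDd x hx).pow 2)).congr_deriv ?_
    ring
  have hfc : Continuous fun x => 2 * k * V x - D x ^ 2 := by fun_prop
  have hfmono : MonotoneOn (fun x => 2 * k * V x - D x ^ 2) (Icc (-δ) 0) := by
    refine monotoneOn_of_deriv_nonneg (convex_Icc _ _) hfc.continuousOn ?_ fun x hx => ?_
    · intro x hx
      rw [interior_Icc] at hx
      exact (hfd x (hleft x hx).1).differentiableAt.differentiableWithinAt
    · rw [interior_Icc] at hx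
      obtain ⟨hx', hDx⟩ := hleft x hx
      rw [(hfd x hx').deriv]
      exact mul_nonneg (by linarith) (sub_nonneg.2 (hv'' x hx'))
  have hfanti : AntitoneOn (fun x => 2 * k * V x - D x ^ 2) (Icc 0 δ) := by
    refine antitoneOn_of_deriv_nonpos (convex_Icc _ _) hfc.continuousOn ?_ fun x hx => ?_
    · intro x hx
      rw [interior_Icc] at hx
      exact (hfd x (hright x hx).1).differentiableAt.differentiableWithinAt
    · rw [interior_Icc] at hx
      obtain ⟨hx', hDx⟩ := hright x hx
      rw [(hfd x hx').deriv]
      exact mul_nonpos_of_nonpos_of_nonneg (by linarith) (sub_nonneg.2 (hv'' x hx'))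
  have hδl : -δ ∈ Icc (-δ) 0 := ⟨le_rfl, by linarith⟩
  have hδr : δ ∈ Icc 0 δ := ⟨hδ.le, le_rfl⟩
  refine ⟨hδ, hVc, hDc, fun x hx => indicator_of_notMem hx _, fun x hx => indicator_of_notMem hx _,
    fun x hx => ?_, hVd, hDd, hv1.continuousOn_deriv_of_isOpen isOpen_Ioo le_rfl, hv'',
    fun x => ?_, fun a ha => ?_⟩
  · rcases le_total x 0 with h0 | h0
    · rw [← hVl]
      exact hmono hδl ⟨hx.1.le, h0⟩ hx.1
    · rw [← hVr]
      exact hanti ⟨h0, hx.2.le⟩ hδr hx.2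
  · by_cases hx : x ∈ Ioo (-δ) δ
    · rcases le_total x 0 with h0 | h0
      · have := hfmono hδl ⟨hx.1.le, h0⟩ hx.1.le
        simp only [hVl, hDl] at this
        linarith
      · have := hfanti ⟨h0, hx.2.le⟩ hδr hx.2.le
        simp only [hVr, hDr] at this
        linarith
    · simp [hV, hD, indicator_of_notMem hx]
  · have hsub : {x | V x = a} ⊆ ({x | V x = a} ∩ Icc (-δ) 0) ∪ ({x | V x = a} ∩ Icc 0 δ) := by
      intro x hx
      have hx' : x ∈ Ioo (-δ) δ := by
        by_contra hc
        exact ha.ne ((indicator_of_notMem hc v).symm.trans hx)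
      rcases le_total x 0 with h0 | h0
      · exact Or.inl ⟨hx, hx'.1.le, h0⟩
      · exact Or.inr ⟨hx, h0, hx'.2.le⟩
    refine Countable.mono hsub (Countable.union ?_ ?_) <;> refine Subsingleton.countable ?_
    · intro x hx y hy
      exact hmono.injOn hx.2 hy.2 (Eq.trans hx.1 (Eq.symm hy.1))
    · intro x hx y hy
      exact hanti.injOn hx.2 hy.2 (Eq.trans hx.1 (Eq.symm hy.1))

/-! ### The super-solution -/

theorem separatedProfile_eq_density {m ν k δ t : ℝ} {v : ℝ → ℝ} (hm : 1 ≤ m) :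
    separatedProfile m ν k δ v t =
      density m fun x => (1 - (2 + m) * ν * k * t)⁻¹ * (Ioo (-δ) δ).indicator v x := by
  ext x
  by_cases hx : x ∈ Ioo (-δ) δ
  · rw [separatedProfile, density, indicator_of_mem hx, indicator_of_mem hx, inv_mul_eq_div]
  · rw [separatedProfile, density, indicator_of_notMem hx, indicator_of_notMem hx, mul_zero,
      Real.zero_rpow (by positivity)]

theorem proposition4p1 (m ν c δ k : ℝ) (hm : 1 ≤ m) (hν : 0 < ν) (hc : 0 < c) (hδ : 0 < δ)
    (v u₀ : ℝ → ℝ)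
    (hv_smooth : ContDiffOn ℝ 2 v (Ioo (-δ) δ))
    (hv_nonneg : ∀ x ∈ Ioo (-δ) δ, 0 ≤ v x)
    (hv_right : Tendsto v (𝓝[<] δ) (𝓝 0))
    (hv'_right : Tendsto (deriv v) (𝓝[<] δ) (𝓝 0))
    (hv_left : Tendsto v (𝓝[>] (-δ)) (𝓝 0))
    (hv'_left : Tendsto (deriv v) (𝓝[>] (-δ)) (𝓝 0))
    (hv_mono : ∀ x ∈ Ioo (-δ) δ, x ≠ 0 → x * deriv v x < 0)
    (hv'' : ∀ x ∈ Ioo (-δ) δ, deriv (deriv v) x ≤ k)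
    -- the datum `u₀` is understood up to null sets
    (hu₀_supp : ∀ᵐ x, x ∉ Icc (-δ) δ → u₀ x = 0)
    (hu₀ : ∀ᵐ x, x ∈ Ioo (-δ) δ → 0 ≤ u₀ x ∧ u₀ x ≤ v x ^ (1 / m)) :
    0 < k ∧
    (∀ T : ℝ, 0 < T → T < 1 / ((2 + m) * ν * k) →
      IsEntropySuperSolution m ν c T (separatedProfile m ν k δ v)) ∧
    (∀ᵐ x, u₀ x ≤ separatedProfile m ν k δ v 0 x) ∧
    (∀ t ∈ Ico 0 (1 / ((2 + m) * ν * k)),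
      tsupport (separatedProfile m ν k δ v t) = tsupport (separatedProfile m ν k δ v 0)) := by
  have hB := isBump_of_profile hδ hv_smooth hv_right hv'_right hv_left hv'_left hv_mono hv''
  -- `k = 0` would force `v' = 0` through `v' ^ 2 ≤ 2 k v`
  have hk : 0 < k := by
    refine hB.K_nonneg.lt_of_ne fun h0 => ?_
    have hmem : δ / 2 ∈ Ioo (-δ) δ := ⟨by linarith, by linarith⟩
    have h1 := hv_mono _ hmem (by positivity)
    have h2 := hB.sq_deriv_le (δ / 2)
    rw [← h0, mul_zero, zero_mul, indicator_of_mem hmem] at h2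
    rw [pow_eq_zero_iff two_ne_zero |>.1 (le_antisymm h2 (sq_nonneg _)), mul_zero] at h1
    exact h1.false
  set r := (2 + m) * ν * k with hr
  have hr0 : 0 < r := by positivity
  have hτ : ∀ {t}, t < 1 / r → 0 < 1 - r * t := fun ht => by
    rw [lt_div_iff₀ hr0] at ht
    linarith
  refine ⟨hk, fun T hT hT' => ?_, ?_, fun t ht => ?_⟩
  · -- the amplitude is frozen after the time `T`, which makes it positive and bounded on the line
    set s : ℝ → ℝ := fun t => (1 - r * min t T)⁻¹ with hs
    have hpos : ∀ t, 1 - r * T ≤ 1 - r * min t T := fun t => by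
      have := mul_le_mul_of_nonneg_left (min_le_right t T) hr0.le
      linarith
    have hsc : Continuous s :=
      Continuous.inv₀ (by fun_prop) fun t => ((hτ hT').trans_le (hpos t)).ne'
    refine (hB.isEntropySuperSolution (S := (1 - r * T)⁻¹) hm hν hsc
      (fun t => inv_pos.2 ((hτ hT').trans_le (hpos t)))
      (fun t => inv_anti₀ (hτ hT') (hpos t)) (fun t ht => ?_) hT).congr fun t ht => ?_
    · have h0 : 0 < 1 - r * t := hτ (ht.2.trans hT')
      have h1 : HasDerivAt (fun t => (1 - r * t)⁻¹) (r * ((1 - r * t)⁻¹) ^ 2) t := by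
        refine ((((hasDerivAt_id' t).const_mul r).const_sub 1).inv h0.ne').congr_deriv ?_
        rw [inv_pow]
        ring
      have h2 : s t = (1 - r * t)⁻¹ := by simp only [hs, min_eq_left ht.2.le]
      rw [h2]
      refine h1.congr_of_eventuallyEq ?_
      filter_upwards [Iio_mem_nhds ht.2] with y hy
      simp only [hs, min_eq_left (show y ≤ T from (mem_Iio.1 hy).le)]
    · rw [separatedProfile_eq_density hm]
      simp only [hs, min_eq_left ht.2]
      rfl
  · have hne : ∀ᵐ x : ℝ, x ≠ δ ∧ x ≠ -δ := by
      filter_upwards [Measure.ae_ne volume δ, Measure.ae_ne volume (-δ)] with x h1 h2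
      exact ⟨h1, h2⟩
    filter_upwards [hu₀_supp, hu₀, hne] with x h1 h2 h3
    rw [separatedProfile]
    by_cases hx : x ∈ Ioo (-δ) δ
    · rw [indicator_of_mem hx, mul_zero, sub_zero, div_one]
      exact (h2 hx).2
    · rw [indicator_of_notMem hx]
      exact (h1 fun hx' => hx ⟨hx'.1.lt_of_ne h3.2.symm, hx'.2.lt_of_ne h3.1⟩).le
  · have hsupp : ∀ t, t < 1 / r →
        Function.support (separatedProfile m ν k δ v t) = Ioo (-δ) δ := by
      intro t ht
      have hBt := hB.smul (inv_pos.2 (hτ ht))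
      rw [separatedProfile_eq_density hm]
      ext x
      exact ⟨fun hx => by_contra fun hc => hx (hBt.density_eq_zero hm hc),
        fun hx => (hBt.density_pos hx).ne'⟩
    rw [tsupport, tsupport, hsupp t ht.2, hsupp 0 (by positivity)]
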